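/- Fix $p \ge 0$. For each $n$ consider an experiment on $n$ units, on its own probability space, with binary treatments $W_1,\dots,W_n$, feature vectors $X_1,\dots,X_n\in\mathbb R^p$ (intercept excluded), errors $\varepsilon_1,\dots,\varepsilon_n$ and responses $$Y_i = W_i(\alpha_1+\eta_1^\top X_i) + (1-W_i)(\alpha_0+\eta_0^\top X_i)+\varepsilon_i .$$ All quantities, including the coefficients $\alpha_w,\eta_w$, may depend on $n$. Write $\mathbf W=(W_1,\dots,W_n)$, $X=(X_1,\dots,X_n)$, and $\mathbf W_{-i}$ for $\mathbf W$ with $W_i$ removed. Assume for every $n$: 1. $W_1,\dots,W_n$ are i.i.d. Bernoulli$(\pi_n)$ with $0<\pi_n<1$, and $X_i$ is independent of $W_i$ for all $i$. 2. Conditionally on $(X,\mathbf W)$, the errors are independent, $E[\varepsilon_i\mid X,\mathbf W]=0$ and $\operatorname{Var}(\varepsilon_i\mid X,\mathbf W)=\sigma_n^2$. 3. Either each $X_i$ is a deterministic function of $\mathbf W_{-i}$, or else the array $(X_1,\dots,X_n)$ is independent of $\mathbf W$. 4. (Static features) $X_i$ is independent of $\mathbf W_{-i}$ for all $i$. Assume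 also that, as $n\to\infty$, $\pi_n\to\pi\in(0,1)$ and $\sigma_n^2\to\sigma^2\ge 0$; that $\bar X=\frac1n\sum_i X_i\to\mu_X$ and $\frac1n\sum_i (X_i-\bar X)(X_i-\bar X)^\top\to\Sigma_X$ in probability, where $\Sigma_X$ is positive definite; and that the fourth moments of all coordinates of the $X_i$ and of all $\varepsilon_i$ are bounded uniformly in $i$ and $n$. For $w\in\{0,1\}$ let $\omega_w=\frac1n\sum_i E[X_i\mid \mathbf W_{-i}=(w,\dots,w)]$. Let $$\tau=\frac1n\sum_i\bigl(E[Y_i\mid \mathbf W=(1,\dots,1)]-E[Y_i\mid \mathbf W=(0,\dots,0)]\bigr)$$ be the global average treatment effect. Let $\hat\beta_w\in\mathbb R^{p+1}$ be the vector of ordinary least squares coefficients in the regression of $Y_i$ on $(1,X_i)$ over the units with $W_i=w$ (defined arbitrarily, say as $0$, when the Gram matrix is singular), and let $\hat\tau=(1,\omega_1)^\top\hat\beta_1-(1,\omega_0)^\top\hat\beta_0$. Then $\omega_0=\omega_1=E[\bar X]$ for every $n$, both $\omega_0$ and $\omega_1$ converge to $\mu_X$ as $n\to\infty$, and $$\sqrt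 n\,(\hat\tau-\tau)\ \Rightarrow\ N\!\left(0,\frac{\sigma^2}{\pi(1-\pi)}\right).$$ -/

import Mathlib

open MeasureTheory ProbabilityTheory Filter Topology
open scoped Matrix NNReal ENNReal

noncomputable section

/-- The random variables and coefficients of one experiment on `n` units with `p` features
(intercept excluded), over a sample space `Ω`. The treatment arms are labelled by `Bool`
(`true` is treatment, `false` is control). -/
structure Experiment (n p : ℕ) (Ω : Type*) [MeasurableSpace Ω] where
  /-- treatment assignments -/
  W : Fin n → Ω → Bool
  /-- feature vectors -/
  X : Fin n → Ω → Fin p → ℝ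
  /-- residuals -/
  ε : Fin n → Ω → ℝ
  /-- intercept of each arm -/
  α : Bool → ℝ
  /-- slope vector of each arm -/
  η : Bool → Fin p → ℝ
  measurable_W : ∀ i, Measurable (W i)
  measurable_X : ∀ i, Measurable (X i)
  measurable_ε : ∀ i, Measurable (ε i)

namespace Experiment

variable {n p : ℕ} {Ω : Type*} [MeasurableSpace Ω]

/-- The whole treatment vector. -/
def treatments (D : Experiment n p Ω) (ω : Ω) : Fin n → Bool := fun i => D.W i ω

/-- The indirect treatments of unit `i`: all treatments except its own. -/
def indirect (D : Experiment n p Ω) (i : Fin n) (ω : Ω) : {j : Fin n // j ≠ i} → Bool :=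
  fun j => D.W j ω

/-- The whole array of features. -/
def features (D : Experiment n p Ω) (ω : Ω) : Fin n → Fin p → ℝ := fun i => D.X i ω

/-- The vector of residuals. -/
def errors (D : Experiment n p Ω) (ω : Ω) : Fin n → ℝ := fun i => D.ε i ω

/-- All features together with all treatments, on which the error assumptions condition. -/
def design (D : Experiment n p Ω) (ω : Ω) : (Fin n → Fin p → ℝ) × (Fin n → Bool) :=
  (D.features ω, D.treatments ω)

/-- The sigma-algebra generated by all features and all treatments. -/
abbrev designSigma (D : Experiment n p Ω) : MeasurableSpace Ω :=
  MeasurableSpace.comap D.design inferInstance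

/-- The linear response surface `α_w + η_w ⬝ x` of arm `w`. -/
def surface (D : Experiment n p Ω) (w : Bool) (x : Fin p → ℝ) : ℝ := D.α w + D.η w ⬝ᵥ x

/-- The observed response of unit `i` (separate-slopes linear model). -/
def Y (D : Experiment n p Ω) (i : Fin n) (ω : Ω) : ℝ :=
  D.surface (D.W i ω) (D.X i ω) + D.ε i ω

/-- The sample mean of the features. -/
def xbar (D : Experiment n p Ω) (ω : Ω) : Fin p → ℝ :=
  fun k => (1 / (n : ℝ)) * ∑ i, D.X i ω k

/-- The sample covariance matrix of the features. -/
def sampleCov (D : Experiment n p Ω) (ω : Ω) : Matrix (Fin p) (Fin p) ℝ :=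
  Matrix.of fun k l =>
    (1 / (n : ℝ)) * ∑ i, (D.X i ω k - D.xbar ω k) * (D.X i ω l - D.xbar ω l)

/-- The mean counterfactual features when everybody is assigned to arm `w`: the average over the
units `i` of `E[X_i | W_{-i} = (w, …, w)]`. When `X_i = x_i(W_{-i})` the `i`-th conditional
expectation is `x_i(w, …, w)`. -/
def omega (D : Experiment n p Ω) (P : Measure Ω) (w : Bool) : Fin p → ℝ :=
  fun k => (1 / (n : ℝ)) * ∑ i, ∫ ω, D.X i ω k ∂(P[|{ω | ∀ j, D.indirect i ω j = w}])

/-- The global average treatment effect: the average over the units of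
`E[Y_i | W = 1] - E[Y_i | W = 0]`. -/
def gate (D : Experiment n p Ω) (P : Measure Ω) : ℝ :=
  (1 / (n : ℝ)) * ∑ i, (∫ ω, D.Y i ω ∂(P[|{ω | ∀ j, D.W j ω = true}])
    - ∫ ω, D.Y i ω ∂(P[|{ω | ∀ j, D.W j ω = false}]))

/-- The design matrix of arm `w`: one row `(1, X_i)` for each unit assigned to arm `w`. -/
def armMatrix (D : Experiment n p Ω) (w : Bool) (ω : Ω) :
    Matrix {i : Fin n // D.W i ω = w} (Fin (p + 1)) ℝ :=
  Matrix.of fun i => Matrix.vecCons 1 (D.X i ω)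

/-- The responses observed in arm `w`. -/
def armResponse (D : Experiment n p Ω) (w : Bool) (ω : Ω) : {i : Fin n // D.W i ω = w} → ℝ :=
  fun i => D.Y i ω

/-- The OLS coefficients (intercept first) of arm `w`. -/
def betaHat (D : Experiment n p Ω) (w : Bool) (ω : Ω) : Fin (p + 1) → ℝ :=
  ((D.armMatrix w ω)ᵀ * D.armMatrix w ω)⁻¹ *ᵥ ((D.armMatrix w ω)ᵀ *ᵥ D.armResponse w ω)

/-- The regression-adjusted estimator of the global average treatment effect. -/
def tauHat (D : Experiment n p Ω) (P : Measure Ω) (ω : Ω) : ℝ :=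
  Matrix.vecCons 1 (D.omega P true) ⬝ᵥ D.betaHat true ω
    - Matrix.vecCons 1 (D.omega P false) ⬝ᵥ D.betaHat false ω

/-- The standing assumptions on one experiment: Bernoulli design with treatment probability `q`,
every feature independent of the unit's own treatment, and errors that, given all features and all
treatments, have mean zero, variance `σ ^ 2`, and are independent. -/
structure Regular (D : Experiment n p Ω) (P : Measure Ω) [IsProbabilityMeasure P] (q σ : ℝ) :
    Prop where
  prob_pos : 0 < q
  prob_lt_one : q < 1
  treatments_indep : iIndepFun D.W P
  treatments_law : ∀ i, P {ω | D.W i ω = true} = ENNReal.ofReal q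
  feature_indep_own : ∀ i, IndepFun (D.X i) (D.W i) P
  errors_memLp : ∀ i, MemLp (D.ε i) 2 P
  errors_exogenous : ∀ i, P[D.ε i | D.designSigma] =ᵐ[P] fun _ => 0
  errors_homoscedastic : ∀ i, condVar D.designSigma (D.ε i) P =ᵐ[P] fun _ => σ ^ 2
  /-- Under the regular conditional law of the error vector given the design, the coordinates are
  independent. -/
  errors_indep : ∀ᵐ z ∂(P.map D.design),
    iIndepFun (fun (i : Fin n) (e : Fin n → ℝ) => e i) (condDistrib D.errors D.design P z)

/-- Every feature vector is (almost surely) a deterministic function of the indirect treatments. -/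
def FeaturesOfIndirect (D : Experiment n p Ω) (P : Measure Ω) : Prop :=
  ∀ i, ∃ x : ({j : Fin n // j ≠ i} → Bool) → Fin p → ℝ, D.X i =ᵐ[P] fun ω => x (D.indirect i ω)

/-- All fourth moments of feature coordinates and of errors are at most `C`. -/
def FourthMomentsLE (D : Experiment n p Ω) (P : Measure Ω) (C : ℝ≥0) : Prop :=
  ∀ i, (∀ k, ∫⁻ ω, ‖D.X i ω k‖ₑ ^ 4 ∂P ≤ C) ∧ ∫⁻ ω, ‖D.ε i ω‖ₑ ^ 4 ∂P ≤ C

end Experiment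

/-- Convergence in probability to the constant `c` of random variables that may live on different
probability spaces. -/
def TendstoInProb {Ω : ℕ → Type*} [∀ n, MeasurableSpace (Ω n)] (P : ∀ n, Measure (Ω n))
    (Z : ∀ n, Ω n → ℝ) (c : ℝ) : Prop :=
  ∀ δ : ℝ, 0 < δ → Tendsto (fun n => P n {ω | δ ≤ |Z n ω - c|}) atTop (𝓝 0)

end

/-! ### Events of probability tending to one -/

section HighProbability

variable {Ω : ℕ → Type*} [∀ n, MeasurableSpace (Ω n)]

/-- The filter of the events whose probability tends to one along a sequence of probability
spaces. Convergence in probability is convergence along this filter. -/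
def whp (P : ∀ n, Measure (Ω n)) : Filter (Σ n, Ω n) where
  sets := {S | Tendsto (fun n => P n {ω | (⟨n, ω⟩ : Σ n, Ω n) ∉ S}) atTop (𝓝 0)}
  univ_sets := by simp
  sets_of_superset := by
    intro S T hS hST
    refine tendsto_of_tendsto_of_tendsto_of_le_of_le tendsto_const_nhds hS (fun _ => zero_le)
      fun n => measure_mono fun ω hω h => hω (hST h)
  inter_sets := by
    intro S T hS hT
    have h := Tendsto.add hS hT
    rw [add_zero] at h
    refine tendsto_of_tendsto_of_tendsto_of_le_of_le tendsto_const_nhds h (fun _ => zero_le)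
      fun n => (measure_mono ?_).trans (measure_union_le _ _)
    intro ω hω
    by_cases h1 : (⟨n, ω⟩ : Σ n, Ω n) ∈ S
    · exact Or.inr fun h2 => hω ⟨h1, h2⟩
    · exact Or.inl h1

variable {P : ∀ n, Measure (Ω n)}

lemma eventually_whp {p : (Σ n, Ω n) → Prop} :
    (∀ᶠ x in whp P, p x) ↔ Tendsto (fun n => P n {ω | ¬ p ⟨n, ω⟩}) atTop (𝓝 0) := Iff.rfl

lemma tendsto_fst_whp : Tendsto (fun x : Σ n, Ω n => x.1) (whp P) atTop := by
  rw [tendsto_atTop]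
  intro N
  rw [eventually_whp]
  refine tendsto_const_nhds.congr' ?_
  filter_upwards [eventually_ge_atTop N] with n hn
  simp [hn]

lemma tendsto_whp_iff {Z : (Σ n, Ω n) → ℝ} {c : ℝ} :
    Tendsto Z (whp P) (𝓝 c) ↔
      ∀ δ : ℝ, 0 < δ → Tendsto (fun n => P n {ω | δ ≤ |Z ⟨n, ω⟩ - c|}) atTop (𝓝 0) := by
  rw [Metric.tendsto_nhds]
  refine forall₂_congr fun δ _ => ?_
  rw [eventually_whp]
  simp [Real.dist_eq]

lemma TendstoInProb.tendsto_whp {Z : ∀ n, Ω n → ℝ} {c : ℝ} (h : TendstoInProb P Z c) :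
    Tendsto (fun x : Σ n, Ω n => Z x.1 x.2) (whp P) (𝓝 c) :=
  (tendsto_whp_iff (Z := fun x : Σ n, Ω n => Z x.1 x.2)).2 h

/-- Chebyshev's inequality for the second moment about zero. -/
lemma measure_le_of_integral_sq_le {α : Type*} [MeasurableSpace α] {μ : Measure α} {Z : α → ℝ}
    {b δ : ℝ} (hδ : 0 < δ) (hZ : Integrable (fun a => Z a ^ 2) μ) (hb : ∫ a, Z a ^ 2 ∂μ ≤ b) :
    μ {a | δ ≤ |Z a|} ≤ ENNReal.ofReal (b / δ ^ 2) := by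
  have h1 : μ {a | ENNReal.ofReal (δ ^ 2) ≤ ENNReal.ofReal (Z a ^ 2)} ≤
      (∫⁻ a, ENNReal.ofReal (Z a ^ 2) ∂μ) / ENNReal.ofReal (δ ^ 2) :=
    meas_ge_le_lintegral_div hZ.1.aemeasurable.ennreal_ofReal (by simpa using hδ.ne') (by simp)
  rw [← ofReal_integral_eq_lintegral_ofReal hZ (ae_of_all _ fun a => sq_nonneg _),
    ← ENNReal.ofReal_div_of_pos (by positivity)] at h1
  refine (measure_mono ?_).trans (h1.trans (ENNReal.ofReal_le_ofReal (by gcongr)))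
  intro a (ha : δ ≤ |Z a|)
  refine ENNReal.ofReal_le_ofReal ?_
  rw [← sq_abs (Z a)]
  gcongr

lemma tendsto_whp_of_integral_sq_le {Z : ∀ n, Ω n → ℝ} {b : ℕ → ℝ}
    (hZ : ∀ n, Integrable (fun ω => Z n ω ^ 2) (P n)) (hZb : ∀ n, ∫ ω, Z n ω ^ 2 ∂(P n) ≤ b n)
    (hb : Tendsto b atTop (𝓝 0)) :
    Tendsto (fun x : Σ n, Ω n => Z x.1 x.2) (whp P) (𝓝 0) := by
  rw [tendsto_whp_iff]
  intro δ hδ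
  have h : Tendsto (fun n => ENNReal.ofReal (b n / δ ^ 2)) atTop (𝓝 0) := by
    simpa using ENNReal.tendsto_ofReal (hb.div_const (δ ^ 2))
  refine tendsto_of_tendsto_of_tendsto_of_le_of_le tendsto_const_nhds h (fun _ => zero_le)
    fun n => ?_
  simpa using measure_le_of_integral_sq_le hδ (hZ n) (hZb n)

/-- A sequence tending to zero in probability times one with bounded second moments tends to zero
in probability. -/
lemma tendsto_whp_zero_mul_of_integral_sq_le {A : (Σ n, Ω n) → ℝ} {Z : ∀ n, Ω n → ℝ} {K : ℝ}
    (hA : Tendsto A (whp P) (𝓝 0))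
    (hZ : ∀ n, Integrable (fun ω => Z n ω ^ 2) (P n))
    (hZb : ∀ᶠ n in atTop, ∫ ω, Z n ω ^ 2 ∂(P n) ≤ K) :
    Tendsto (fun x : Σ n, Ω n => A x * Z x.1 x.2) (whp P) (𝓝 0) := by
  rw [tendsto_whp_iff] at hA ⊢
  intro δ hδ
  rw [ENNReal.tendsto_nhds_zero]
  intro e he
  obtain ⟨r, hr, hre⟩ : ∃ r : ℝ, 0 < r ∧ ENNReal.ofReal (K / (δ / r) ^ 2) ≤ e / 2 := by
    have hc : Tendsto (fun r : ℝ => ENNReal.ofReal (K / (δ / r) ^ 2)) (𝓝[>] 0) (𝓝 0) := by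
      have : Tendsto (fun r : ℝ => K / δ ^ 2 * r ^ 2) (𝓝 0) (𝓝 (K / δ ^ 2 * 0 ^ 2)) :=
        (tendsto_id.pow 2).const_mul _
      have h2 := ENNReal.tendsto_ofReal (this.mono_left (nhdsWithin_le_nhds (s := Set.Ioi 0)))
      simp only [ne_eq, OfNat.ofNat_ne_zero, not_false_eq_true, zero_pow, mul_zero,
        ENNReal.ofReal_zero] at h2
      refine h2.congr' ?_
      filter_upwards [self_mem_nhdsWithin] with r (hr : 0 < r)
      congr 1
      field_simp
    rw [ENNReal.tendsto_nhds_zero] at hc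
    obtain ⟨r, h1, h2⟩ := ((hc (e / 2) (ENNReal.half_pos he.ne')).and
      self_mem_nhdsWithin).exists
    exact ⟨r, h2, h1⟩
  have hA' := hA r hr
  rw [ENNReal.tendsto_nhds_zero] at hA'
  filter_upwards [hA' (e / 2) (ENNReal.half_pos he.ne'), hZb] with n hn hKn
  have hsub : {ω | δ ≤ |A ⟨n, ω⟩ * Z n ω - 0|} ⊆
      {ω | r ≤ |A ⟨n, ω⟩ - 0|} ∪ {ω | δ / r ≤ |Z n ω|} := by
    intro ω hω
    by_contra hcon
    simp only [Set.mem_union, Set.mem_ofPred_eq, not_or, not_le, sub_zero] at hcon hω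
    have : |A ⟨n, ω⟩| * |Z n ω| < r * (δ / r) :=
      mul_lt_mul'' hcon.1 hcon.2 (abs_nonneg _) (abs_nonneg _)
    rw [← abs_mul, mul_div_cancel₀ _ hr.ne'] at this
    linarith
  calc _ ≤ _ := measure_mono hsub
    _ ≤ _ := measure_union_le _ _
    _ ≤ e / 2 + e / 2 := by
        gcongr
        exact (measure_le_of_integral_sq_le (by positivity) (hZ n) hKn).trans hre
    _ = e := ENNReal.add_halves e

/-- Convergence in probability together with bounded second moments gives convergence of means. -/
lemma tendsto_integral_of_tendsto_whp [∀ n, IsProbabilityMeasure (P n)] {Z : ∀ n, Ω n → ℝ}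
    {c K : ℝ} (hZc : Tendsto (fun x : Σ n, Ω n => Z x.1 x.2) (whp P) (𝓝 c))
    (hm : ∀ n, Measurable (Z n))
    (hZ : ∀ n, Integrable (fun ω => Z n ω ^ 2) (P n))
    (hZb : ∀ n, ∫ ω, Z n ω ^ 2 ∂(P n) ≤ K) :
    Tendsto (fun n => ∫ ω, Z n ω ∂(P n)) atTop (𝓝 c) := by
  have hL2 : ∀ n, MemLp (Z n) 2 (P n) := fun n =>
    (memLp_two_iff_integrable_sq (hm n).aestronglyMeasurable).2 (hZ n)
  have hi : ∀ n, Integrable (Z n) (P n) := fun n => (hL2 n).integrable (by norm_num)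
  have hL2' : ∀ n, MemLp (fun ω => Z n ω - c) 2 (P n) := fun n => (hL2 n).sub (memLp_const c)
  set M : ℝ := 2 * K + 2 * c ^ 2
  have hK : 0 ≤ K := (integral_nonneg fun _ => sq_nonneg _).trans (hZb 0)
  have hM : ∀ n, ∫ ω, (Z n ω - c) ^ 2 ∂(P n) ≤ M := by
    intro n
    calc ∫ ω, (Z n ω - c) ^ 2 ∂(P n) ≤ ∫ ω, (2 * Z n ω ^ 2 + 2 * c ^ 2) ∂(P n) := by
          refine integral_mono (hL2' n).integrable_sq
            (((hZ n).const_mul 2).add (integrable_const _)) fun ω => ?_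
          nlinarith [sq_nonneg (Z n ω + c)]
      _ = 2 * ∫ ω, Z n ω ^ 2 ∂(P n) + 2 * c ^ 2 := by
          rw [integral_add ((hZ n).const_mul 2) (integrable_const _), integral_const_mul]
          simp
      _ ≤ M := by
          have := hZb n
          simp only [M]; linarith
  rw [Metric.tendsto_atTop']
  intro e he
  have hM0 : 0 ≤ M := by positivity
  set r : ℝ := e / (4 * (M + 1)) with hr
  have hr0 : 0 < r := by positivity
  have hprob := (tendsto_whp_iff.1 hZc) (e / 4) (by positivity)
  rw [ENNReal.tendsto_nhds_zero] at hprob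
  obtain ⟨N, hN⟩ := eventually_atTop.1 (hprob (ENNReal.ofReal (e / 4 * r)) (by simp; positivity))
  refine ⟨N, fun n hn => ?_⟩
  set S : Set (Ω n) := {ω | e / 4 ≤ |Z n ω - c|}
  have hS : MeasurableSet S := measurableSet_le measurable_const ((hm n).sub_const c).abs
  have hPS : (P n).real S ≤ e / 4 * r :=
    ENNReal.toReal_le_of_le_ofReal (by positivity) (hN n hn.le)
  rw [Real.dist_eq]
  have h1 : ∫ ω, Z n ω ∂(P n) - c = ∫ ω, (Z n ω - c) ∂(P n) := by
    rw [integral_sub (hi n) (integrable_const c)]; simp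
  have hSi : Integrable (S.indicator fun _ => (1 : ℝ)) (P n) :=
    (integrable_const _).indicator hS
  rw [h1]
  calc |∫ ω, (Z n ω - c) ∂(P n)| ≤ ∫ ω, |Z n ω - c| ∂(P n) := abs_integral_le_integral_abs
    _ ≤ ∫ ω, (e / 4 + r * (Z n ω - c) ^ 2 + (1 / r) * S.indicator (fun _ => (1 : ℝ)) ω)
          ∂(P n) := by
        refine integral_mono ((hi n).sub (integrable_const c)).abs
          (((integrable_const _).add ((hL2' n).integrable_sq.const_mul r)).add
            (hSi.const_mul _)) fun ω => ?_
        by_cases hω : ω ∈ S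
        · simp only [hω, Set.indicator_of_mem]
          have h2 : 0 ≤ (r * |Z n ω - c| - 1) ^ 2 := sq_nonneg _
          have h3 : |Z n ω - c| * (2 * r) ≤ (r * (Z n ω - c) ^ 2 + 1 / r) * r := by
            rw [← sq_abs (Z n ω - c)]; field_simp; nlinarith
          have h4 : 0 ≤ |Z n ω - c| := abs_nonneg _
          have h5 : |Z n ω - c| * 2 ≤ r * (Z n ω - c) ^ 2 + 1 / r :=
            le_of_mul_le_mul_right (by linarith) hr0
          linarith
        · simp only [hω, not_false_eq_true, Set.indicator_of_notMem, mul_zero, add_zero]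
          have h2 : |Z n ω - c| < e / 4 := not_le.1 hω
          have h3 : 0 ≤ r * (Z n ω - c) ^ 2 := by positivity
          linarith
    _ = e / 4 + r * ∫ ω, (Z n ω - c) ^ 2 ∂(P n) + (1 / r) * (P n).real S := by
        rw [integral_add ((integrable_const _).fun_add ((hL2' n).integrable_sq.const_mul r))
            (hSi.const_mul _), integral_add (integrable_const _)
            ((hL2' n).integrable_sq.const_mul r), integral_const_mul, integral_const_mul,
            integral_indicator_const _ hS]
        simp
    _ ≤ e / 4 + r * M + (1 / r) * (e / 4 * r) := by
        have := hM n
        gcongr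
    _ < e := by
        have h2 : r * M ≤ e / 4 := by
          rw [hr, div_mul_eq_mul_div, div_le_div_iff₀ (by positivity) (by positivity)]
          nlinarith
        have h3 : (1 / r) * (e / 4 * r) = e / 4 := by field_simp
        linarith

end HighProbability

/-! ### Elementary estimates for characteristic functions -/

lemma norm_prod_sub_prod_le_sum {ι : Type*} (s : Finset ι) (f g : ι → ℂ)
    (hf : ∀ i ∈ s, ‖f i‖ ≤ 1) (hg : ∀ i ∈ s, ‖g i‖ ≤ 1) :
    ‖∏ i ∈ s, f i - ∏ i ∈ s, g i‖ ≤ ∑ i ∈ s, ‖f i - g i‖ := by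
  classical
  induction s using Finset.induction_on with
  | empty => simp
  | insert a s ha ih =>
    rw [Finset.prod_insert ha, Finset.prod_insert ha, Finset.sum_insert ha]
    have hfs := ih (fun i hi => hf i (Finset.mem_insert_of_mem hi))
      (fun i hi => hg i (Finset.mem_insert_of_mem hi))
    have hp : ‖∏ i ∈ s, f i‖ ≤ 1 := by
      rw [norm_prod]
      exact Finset.prod_le_one (fun _ _ => norm_nonneg _)
        fun i hi => hf i (Finset.mem_insert_of_mem hi)
    have hga := hg a (Finset.mem_insert_self a s)
    calc ‖f a * ∏ i ∈ s, f i - g a * ∏ i ∈ s, g i‖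
        = ‖(f a - g a) * ∏ i ∈ s, f i + g a * (∏ i ∈ s, f i - ∏ i ∈ s, g i)‖ := by
          congr 1; ring
      _ ≤ ‖f a - g a‖ * ‖∏ i ∈ s, f i‖ + ‖g a‖ * ‖∏ i ∈ s, f i - ∏ i ∈ s, g i‖ := by
          rw [← norm_mul, ← norm_mul]; exact norm_add_le _ _
      _ ≤ ‖f a - g a‖ * 1 + 1 * ‖∏ i ∈ s, f i - ∏ i ∈ s, g i‖ := by gcongr
      _ ≤ _ := by linarith

lemma norm_exp_ofReal_mul_I_sub_taylor_le (x : ℝ) :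
    ‖Complex.exp (x * Complex.I) - (1 + x * Complex.I - (x : ℂ) ^ 2 / 2)‖ ≤ 4 * |x| ^ 3 := by
  have hnx : ‖(x : ℂ) * Complex.I‖ = |x| := by simp
  rcases le_or_gt |x| 1 with hx | hx
  · have h := Complex.exp_bound (x := x * Complex.I) (by rw [hnx]; exact hx) (n := 3) (by norm_num)
    rw [hnx] at h
    have hs : ∑ m ∈ Finset.range 3, ((x : ℂ) * Complex.I) ^ m / (m.factorial : ℂ) =
        1 + x * Complex.I - (x : ℂ) ^ 2 / 2 := by
      simp [Finset.sum_range_succ, mul_pow, Complex.I_sq]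
      ring
    rw [hs] at h
    refine h.trans ?_
    rw [mul_comm]
    gcongr
    norm_num [Nat.factorial]
  · calc _ ≤ ‖Complex.exp (x * Complex.I)‖ + ‖1 + x * Complex.I - (x : ℂ) ^ 2 / 2‖ :=
          norm_sub_le _ _
      _ ≤ 1 + (1 + |x| + |x| ^ 2 / 2) := by
          gcongr
          · rw [Complex.norm_exp_ofReal_mul_I]
          · refine (norm_sub_le _ _).trans ?_
            gcongr
            · refine (norm_add_le _ _).trans ?_
              rw [hnx]; simp
            · simp
      _ ≤ 4 * |x| ^ 3 := by
          have h2 : 1 ≤ |x| ^ 2 := by nlinarith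
          nlinarith [mul_le_mul_of_nonneg_left h2 (abs_nonneg x)]

lemma abs_exp_neg_sub_le {y : ℝ} (hy : 0 ≤ y) : |Real.exp (-y) - (1 - y)| ≤ y ^ 2 := by
  have h1 : 1 - y ≤ Real.exp (-y) := by linarith [Real.add_one_le_exp (-y)]
  have h2 : Real.exp (-y) ≤ 1 / (1 + y) := by
    rw [Real.exp_neg, ← one_div]
    exact one_div_le_one_div_of_le (by linarith) (by linarith [Real.add_one_le_exp y])
  have h3 : 1 / (1 + y) ≤ 1 - y + y ^ 2 := by
    rw [div_le_iff₀ (by linarith)]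
    nlinarith [pow_nonneg hy 3]
  rw [abs_of_nonneg (by linarith)]
  linarith

/-- Second-order expansion of a characteristic function, with a fourth-moment remainder. -/
lemma norm_integral_exp_sub_exp_le {α : Type*} [MeasurableSpace α] {μ : Measure α}
    [IsProbabilityMeasure μ] {e : α → ℝ} (he : Measurable e) (he4 : Integrable (fun a => e a ^ 4) μ)
    {s : ℝ} (h0 : ∫ a, e a ∂μ = 0) (h2 : ∫ a, e a ^ 2 ∂μ = s ^ 2) (c : ℝ) :
    ‖∫ a, Complex.exp ((c * e a : ℝ) * Complex.I) ∂μ - (Real.exp (-(c ^ 2 * s ^ 2 / 2)) : ℝ)‖ ≤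
      4 * |c| ^ 3 * (1 + ∫ a, e a ^ 4 ∂μ) + c ^ 4 * s ^ 4 := by
  have hL4 : ∀ k : ℕ, k ≤ 4 → Integrable (fun a => |e a| ^ k) μ := by
    intro k hk
    refine ((integrable_const (1 : ℝ)).add he4).mono' (by fun_prop) (ae_of_all _ fun a => ?_)
    simp only [norm_pow, Real.norm_eq_abs, abs_abs, Pi.add_apply]
    have h4 : e a ^ 4 = |e a| ^ 4 := by rw [← abs_pow, abs_of_nonneg (by positivity)]
    rw [h4]
    rcases le_or_gt |e a| 1 with h | h
    · have := pow_le_one₀ (n := k) (abs_nonneg (e a)) h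
      have : 0 ≤ |e a| ^ 4 := by positivity
      linarith
    · have := pow_le_pow_right₀ h.le hk
      linarith
  have hi1 : Integrable e μ := by
    have := hL4 1 (by norm_num)
    simp only [pow_one] at this
    exact (integrable_norm_iff he.aestronglyMeasurable).1 this
  have hi2 : Integrable (fun a => e a ^ 2) μ := by simpa using hL4 2 (by norm_num)
  have hexp : Integrable (fun a => Complex.exp ((c * e a : ℝ) * Complex.I)) μ := by
    refine Integrable.of_bound (by fun_prop) 1 (ae_of_all _ fun a => ?_)
    rw [Complex.norm_exp_ofReal_mul_I]
  have hT1 : Integrable (fun a => ((c * e a : ℝ) : ℂ) * Complex.I) μ :=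
    ((hi1.const_mul c).ofReal).mul_const _
  have hT2 : Integrable (fun a => ((c * e a : ℝ) : ℂ) ^ 2 / 2) μ := by
    have : Integrable (fun a => ((c ^ 2 * e a ^ 2 : ℝ) : ℂ) / 2) μ :=
      ((hi2.const_mul (c ^ 2)).ofReal (𝕜 := ℂ)).div_const 2
    refine this.congr (ae_of_all _ fun a => ?_)
    push_cast; ring
  have hT : Integrable
      (fun a => 1 + ((c * e a : ℝ) : ℂ) * Complex.I - ((c * e a : ℝ) : ℂ) ^ 2 / 2) μ :=
    ((integrable_const _).add hT1).sub hT2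
  have hTaylor : ∫ a, (1 + ((c * e a : ℝ) : ℂ) * Complex.I - ((c * e a : ℝ) : ℂ) ^ 2 / 2) ∂μ =
      ((1 - c ^ 2 * s ^ 2 / 2 : ℝ) : ℂ) := by
    have e1 : ∫ a, ((c * e a : ℝ) : ℂ) * Complex.I ∂μ = 0 := by
      rw [integral_mul_const, integral_complex_ofReal, integral_const_mul, h0]; simp
    have e2 : ∫ a, ((c * e a : ℝ) : ℂ) ^ 2 / 2 ∂μ = ((c ^ 2 * s ^ 2 / 2 : ℝ) : ℂ) := by
      rw [← h2, ← integral_const_mul, ← integral_div, ← integral_complex_ofReal]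
      refine integral_congr_ae (ae_of_all _ fun a => ?_)
      push_cast; ring
    rw [integral_sub ((integrable_const _).fun_add hT1) hT2, integral_add (integrable_const _) hT1,
      e1, e2]
    simp
  have hA : ‖∫ a, Complex.exp ((c * e a : ℝ) * Complex.I) ∂μ - ((1 - c ^ 2 * s ^ 2 / 2 : ℝ) : ℂ)‖
      ≤ 4 * |c| ^ 3 * (1 + ∫ a, e a ^ 4 ∂μ) := by
    rw [← hTaylor, ← integral_sub hexp hT]
    refine (norm_integral_le_integral_norm _).trans ?_
    have hr : 4 * |c| ^ 3 * (1 + ∫ a, e a ^ 4 ∂μ) = ∫ a, 4 * |c| ^ 3 * (1 + e a ^ 4) ∂μ := by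
      rw [integral_const_mul, integral_add (integrable_const _) he4]; simp
    rw [hr]
    refine integral_mono (hexp.sub hT).norm
      (((integrable_const _).add he4).const_mul _) fun a => ?_
    refine (norm_exp_ofReal_mul_I_sub_taylor_le (c * e a)).trans ?_
    rw [abs_mul, mul_pow, ← mul_assoc]
    gcongr
    have h4 : e a ^ 4 = |e a| ^ 4 := by rw [← abs_pow, abs_of_nonneg (by positivity)]
    rw [h4]
    rcases le_or_gt |e a| 1 with h | h
    · have := pow_le_one₀ (n := 3) (abs_nonneg (e a)) h
      have : 0 ≤ |e a| ^ 4 := by positivity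
      linarith
    · have := pow_le_pow_right₀ h.le (show 3 ≤ 4 by norm_num)
      linarith
  have hB : ‖((1 - c ^ 2 * s ^ 2 / 2 : ℝ) : ℂ) - (Real.exp (-(c ^ 2 * s ^ 2 / 2)) : ℝ)‖ ≤
      c ^ 4 * s ^ 4 := by
    rw [← Complex.ofReal_sub, Complex.norm_real, Real.norm_eq_abs, abs_sub_comm]
    refine (abs_exp_neg_sub_le (by positivity)).trans ?_
    have : 0 ≤ c ^ 4 * s ^ 4 := by positivity
    nlinarith
  calc _ ≤ _ := norm_sub_le_norm_sub_add_norm_sub _ ((1 - c ^ 2 * s ^ 2 / 2 : ℝ) : ℂ) _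
    _ ≤ _ := add_le_add hA hB

/-! ### The limit of the normalized Gram matrices -/

section LimitGram

variable {p : ℕ}

/-- A `p × p` matrix bordered by a zero row and a zero column in front. -/
def borderZero (S : Matrix (Fin p) (Fin p) ℝ) : Matrix (Fin (p + 1)) (Fin (p + 1)) ℝ :=
  Matrix.of (Fin.cons (fun _ => 0) fun k => Fin.cons 0 (S k))

/-- The second moment matrix of `(1, X)` when `X` has mean `m` and covariance `S`. -/
def momentMatrix (m : Fin p → ℝ) (S : Matrix (Fin p) (Fin p) ℝ) :
    Matrix (Fin (p + 1)) (Fin (p + 1)) ℝ :=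
  Matrix.vecMulVec (Matrix.vecCons 1 m) (Matrix.vecCons 1 m) + borderZero S

lemma momentMatrix_zero_row (m : Fin p → ℝ) (S : Matrix (Fin p) (Fin p) ℝ) (l : Fin (p + 1)) :
    momentMatrix m S 0 l = Matrix.vecCons 1 m l := by
  simp [momentMatrix, borderZero]

lemma dotProduct_borderZero_mulVec (S : Matrix (Fin p) (Fin p) ℝ) (x : Fin (p + 1) → ℝ) :
    x ⬝ᵥ borderZero S *ᵥ x = Fin.tail x ⬝ᵥ S *ᵥ Fin.tail x := by
  simp [borderZero, dotProduct, Matrix.mulVec, Fin.sum_univ_succ, Fin.tail]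

lemma isUnit_momentMatrix (m : Fin p → ℝ) {S : Matrix (Fin p) (Fin p) ℝ} (hS : S.PosDef) :
    IsUnit (momentMatrix m S) := by
  rw [← Matrix.mulVec_injective_iff_isUnit]
  rw [← Matrix.coe_mulVecLin, ← LinearMap.ker_eq_bot, LinearMap.ker_eq_bot']
  intro x hx
  rw [Matrix.mulVecLin_apply] at hx
  have h : x ⬝ᵥ momentMatrix m S *ᵥ x =
      (Matrix.vecCons 1 m ⬝ᵥ x) ^ 2 + Fin.tail x ⬝ᵥ S *ᵥ Fin.tail x := by
    rw [momentMatrix, Matrix.add_mulVec, dotProduct_add, dotProduct_borderZero_mulVec,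
      Matrix.vecMulVec_mulVec]
    simp [dotProduct_comm x]
    ring
  rw [hx, dotProduct_zero] at h
  have htail : Fin.tail x = 0 := by
    by_contra hne
    have := hS.dotProduct_mulVec_pos hne
    simp only [star_trivial] at this
    nlinarith [sq_nonneg (Matrix.vecCons 1 m ⬝ᵥ x)]
  have hk : ∀ k : Fin p, x k.succ = 0 := fun k => congrFun htail k
  have h0 : x 0 = 0 := by
    rw [htail] at h
    simpa [dotProduct, Fin.sum_univ_succ, hk] using h.symm
  funext k
  refine Fin.cases h0 (fun k => hk k) k

lemma vecMul_inv_momentMatrix (m : Fin p → ℝ) {S : Matrix (Fin p) (Fin p) ℝ} (hS : S.PosDef) :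
    Matrix.vecCons 1 m ᵥ* (momentMatrix m S)⁻¹ = Pi.single 0 1 := by
  have hv : Matrix.vecCons 1 m = Pi.single 0 1 ᵥ* momentMatrix m S := by
    funext l
    rw [Matrix.single_one_vecMul]
    exact (momentMatrix_zero_row m S l).symm
  rw [hv, Matrix.vecMul_vecMul, Matrix.mul_nonsing_inv _
    ((Matrix.isUnit_iff_isUnit_det _).1 (isUnit_momentMatrix m hS)), Matrix.vecMul_one]

end LimitGram

/-! ### The regression in one arm -/

namespace Experiment

variable {n p : ℕ} {Ω : Type*} [MeasurableSpace Ω]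

/-- The regressors `(1, X_i)` of unit `i`. -/
def regressor (D : Experiment n p Ω) (i : Fin n) (ω : Ω) : Fin (p + 1) → ℝ :=
  Matrix.vecCons 1 (D.X i ω)

/-- The indicator that unit `i` is in arm `w`. -/
def armInd (D : Experiment n p Ω) (w : Bool) (i : Fin n) (ω : Ω) : ℝ :=
  if D.W i ω = w then 1 else 0

/-- The Gram matrix of arm `w`, as a sum over all units. -/
def gram (D : Experiment n p Ω) (w : Bool) (ω : Ω) : Matrix (Fin (p + 1)) (Fin (p + 1)) ℝ :=
  Matrix.of fun k l => ∑ i, D.armInd w i ω * (D.regressor i ω k * D.regressor i ω l)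

/-- The regressors of arm `w` times the errors. -/
def score (D : Experiment n p Ω) (w : Bool) (ω : Ω) : Fin (p + 1) → ℝ :=
  fun k => ∑ i, D.armInd w i ω * (D.regressor i ω k * D.ε i ω)

/-- The coefficients (intercept first) of the response surface of arm `w`. -/
def beta (D : Experiment n p Ω) (w : Bool) : Fin (p + 1) → ℝ := Matrix.vecCons (D.α w) (D.η w)

variable (D : Experiment n p Ω)

lemma sum_arm_eq (w : Bool) (ω : Ω) (f : Fin n → ℝ) :
    ∑ i : {i : Fin n // D.W i ω = w}, f i = ∑ i, D.armInd w i ω * f i := by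
  simp only [armInd, ite_mul, one_mul, zero_mul]
  rw [← Finset.sum_filter]
  exact (Finset.sum_subtype _ (by simp) f).symm

lemma armMatrix_transpose_mul_self (w : Bool) (ω : Ω) :
    (D.armMatrix w ω)ᵀ * D.armMatrix w ω = D.gram w ω := by
  ext k l
  rw [Matrix.mul_apply]
  exact D.sum_arm_eq w ω fun i => D.regressor i ω k * D.regressor i ω l

lemma armMatrix_transpose_mulVec (w : Bool) (ω : Ω) :
    (D.armMatrix w ω)ᵀ *ᵥ D.armResponse w ω =
      fun k => ∑ i, D.armInd w i ω * (D.regressor i ω k * D.Y i ω) := by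
  funext k
  exact D.sum_arm_eq w ω fun i => D.regressor i ω k * D.Y i ω

lemma surface_eq (w : Bool) (i : Fin n) (ω : Ω) :
    D.surface w (D.X i ω) = ∑ l, D.regressor i ω l * D.beta w l := by
  simp [surface, regressor, beta, Fin.sum_univ_succ, dotProduct, mul_comm]

lemma armMatrix_transpose_mulVec_eq_add (w : Bool) (ω : Ω) :
    (D.armMatrix w ω)ᵀ *ᵥ D.armResponse w ω = D.gram w ω *ᵥ D.beta w + D.score w ω := by
  rw [armMatrix_transpose_mulVec]
  funext k
  have h : ∀ i, D.armInd w i ω * (D.regressor i ω k * D.Y i ω) =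
      ∑ l, D.armInd w i ω * (D.regressor i ω k * D.regressor i ω l) * D.beta w l +
        D.armInd w i ω * (D.regressor i ω k * D.ε i ω) := by
    intro i
    by_cases hw : D.W i ω = w
    · rw [Y, hw, surface_eq, mul_add, mul_add, Finset.mul_sum, Finset.mul_sum]
      congr 1
      exact Finset.sum_congr rfl fun l _ => by ring
    · simp [armInd, hw]
  simp only [h, Finset.sum_add_distrib, Pi.add_apply, score, Matrix.mulVec, dotProduct, gram,
    Matrix.of_apply, Finset.sum_mul]
  rw [Finset.sum_comm]

lemma betaHat_eq (w : Bool) (ω : Ω) :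
    D.betaHat w ω = (D.gram w ω)⁻¹ *ᵥ (D.gram w ω *ᵥ D.beta w + D.score w ω) := by
  rw [betaHat, armMatrix_transpose_mul_self, armMatrix_transpose_mulVec_eq_add]

lemma betaHat_eq_beta_add {w : Bool} {ω : Ω} (h : IsUnit (D.gram w ω).det) :
    D.betaHat w ω = D.beta w + (D.gram w ω)⁻¹ *ᵥ D.score w ω := by
  rw [betaHat_eq, Matrix.mulVec_add, Matrix.mulVec_mulVec, Matrix.nonsing_inv_mul _ h,
    Matrix.one_mulVec]

/-! ### Measurability -/

lemma measurable_design : Measurable D.design := by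
  refine Measurable.prodMk ?_ ?_
  · exact measurable_pi_lambda _ fun i => D.measurable_X i
  · exact measurable_pi_lambda _ fun i => D.measurable_W i

lemma measurable_errors : Measurable D.errors := measurable_pi_lambda _ fun i => D.measurable_ε i

lemma measurable_X_apply (i : Fin n) (k : Fin p) : Measurable fun ω => D.X i ω k :=
  (measurable_pi_apply k).comp (D.measurable_X i)

lemma measurable_regressor (i : Fin n) (k : Fin (p + 1)) :
    Measurable fun ω => D.regressor i ω k := by
  refine Fin.cases ?_ (fun k => ?_) k
  · simp [regressor]
  · simpa [regressor] using D.measurable_X_apply i k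

lemma measurable_armInd (w : Bool) (i : Fin n) : Measurable (D.armInd w i) :=
  (measurable_of_countable fun b : Bool => if b = w then (1 : ℝ) else 0).comp (D.measurable_W i)

lemma measurable_gram (w : Bool) (k l : Fin (p + 1)) : Measurable fun ω => D.gram w ω k l := by
  simp only [gram, Matrix.of_apply]
  exact Finset.measurable_sum _ fun i _ => (D.measurable_armInd w i).mul
    ((D.measurable_regressor i k).mul (D.measurable_regressor i l))

lemma measurable_score (w : Bool) (k : Fin (p + 1)) : Measurable fun ω => D.score w ω k :=
  Finset.measurable_sum _ fun i _ => (D.measurable_armInd w i).mul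
    ((D.measurable_regressor i k).mul (D.measurable_ε i))

lemma measurable_det {α ι : Type*} [MeasurableSpace α] [Fintype ι] [DecidableEq ι]
    {A : α → Matrix ι ι ℝ} (hA : ∀ i j, Measurable fun a => A a i j) :
    Measurable fun a => (A a).det := by
  simp only [Matrix.det_apply]
  exact Finset.measurable_sum _ fun σ _ =>
    (Finset.measurable_prod _ fun i _ => hA _ _).const_smul _

lemma measurable_matrix_inv {α ι : Type*} [MeasurableSpace α] [Fintype ι] [DecidableEq ι]
    {A : α → Matrix ι ι ℝ} (hA : ∀ i j, Measurable fun a => A a i j) (i j : ι) :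
    Measurable fun a => (A a)⁻¹ i j := by
  simp only [Matrix.inv_def, Matrix.smul_apply, Ring.inverse_eq_inv', smul_eq_mul,
    Matrix.adjugate_apply]
  refine (measurable_det hA).inv.mul (measurable_det fun k l => ?_)
  by_cases hk : k = j
  · subst hk
    simp
  · simpa [Matrix.updateRow_ne hk] using hA k l

lemma measurable_betaHat (w : Bool) (k : Fin (p + 1)) : Measurable fun ω => D.betaHat w ω k := by
  simp only [betaHat_eq, Matrix.mulVec, dotProduct, Pi.add_apply]
  exact Finset.measurable_sum _ fun l _ =>
    (measurable_matrix_inv (D.measurable_gram w) k l).mul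
      ((Finset.measurable_sum _ fun j _ => (D.measurable_gram w l j).mul_const _).add
        (D.measurable_score w l))

lemma measurable_tauHat (P : Measure Ω) : Measurable (D.tauHat P) := by
  have h : ∀ (w : Bool) (v : Fin (p + 1) → ℝ), Measurable fun ω => v ⬝ᵥ D.betaHat w ω :=
    fun w v => Finset.measurable_sum _ fun k _ => (D.measurable_betaHat w k).const_mul _
  exact (h true _).sub (h false _)

/-! ### Sample moments of the regressors -/

lemma sum_regressor_mul_regressor (hn : n ≠ 0) (ω : Ω) (k l : Fin (p + 1)) :
    (1 / (n : ℝ)) * ∑ i, D.regressor i ω k * D.regressor i ω l =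
      momentMatrix (D.xbar ω) (D.sampleCov ω) k l := by
  have hn' : (n : ℝ) ≠ 0 := by exact_mod_cast hn
  have hx : ∀ k, ∑ i, D.X i ω k = n * D.xbar ω k := fun k => by
    simp only [xbar]; field_simp
  refine Fin.cases ?_ (fun k => ?_) k
  · refine Fin.cases ?_ (fun l => ?_) l
    · simp [regressor, momentMatrix, borderZero, hn']
    · simp [regressor, momentMatrix, borderZero, xbar]
  · refine Fin.cases ?_ (fun l => ?_) l
    · simp [regressor, momentMatrix, borderZero, xbar]
    · simp only [regressor, Matrix.cons_val_succ, momentMatrix, Matrix.add_apply,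
        Matrix.vecMulVec_apply, borderZero, Matrix.of_apply, Fin.cons_succ, sampleCov]
      have : ∑ i, (D.X i ω k - D.xbar ω k) * (D.X i ω l - D.xbar ω l) =
          ∑ i, D.X i ω k * D.X i ω l - n * (D.xbar ω k * D.xbar ω l) := by
        have e : ∀ i, (D.X i ω k - D.xbar ω k) * (D.X i ω l - D.xbar ω l) =
            D.X i ω k * D.X i ω l - D.X i ω k * D.xbar ω l - D.xbar ω k * D.X i ω l +
              D.xbar ω k * D.xbar ω l := fun i => by ring
        simp only [e, Finset.sum_add_distrib, Finset.sum_sub_distrib, ← Finset.sum_mul,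
          ← Finset.mul_sum, hx, Finset.sum_const, Finset.card_univ, Fintype.card_fin,
          nsmul_eq_mul]
        ring
      rw [this]
      field_simp
      ring

end Experiment

/-! ### Moments and conditioning -/

lemma integrable_pow_four_of_lintegral_le {α : Type*} [MeasurableSpace α] {μ : Measure α}
    {f : α → ℝ} (hf : Measurable f) {C : ℝ≥0} (h : ∫⁻ a, ‖f a‖ₑ ^ 4 ∂μ ≤ C) :
    Integrable (fun a => f a ^ 4) μ ∧ ∫ a, f a ^ 4 ∂μ ≤ C := by
  have he : ∀ a, ENNReal.ofReal (f a ^ 4) = ‖f a‖ₑ ^ 4 := fun a => by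
    rw [← enorm_pow, Real.enorm_eq_ofReal (by positivity)]
  have hi : Integrable (fun a => f a ^ 4) μ := by
    refine ⟨by fun_prop, ?_⟩
    rw [hasFiniteIntegral_iff_enorm]
    simp only [enorm_pow]
    exact h.trans_lt ENNReal.coe_lt_top
  refine ⟨hi, ?_⟩
  rw [integral_eq_lintegral_of_nonneg_ae (ae_of_all _ fun a => by positivity) hi.1]
  simp only [he]
  exact ENNReal.toReal_le_coe_of_le_coe h

/-- Conditioning on an event determined by `g` does not change the law of an `f` independent
of `g`. -/
lemma map_cond_of_indepFun {α β γ : Type*} [MeasurableSpace α] [MeasurableSpace β]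
    [MeasurableSpace γ] {μ : Measure α} [IsProbabilityMeasure μ] {f : α → β} {g : α → γ}
    (hf : Measurable f) (hg : Measurable g) (h : IndepFun f g μ) {s : Set γ}
    (hs : MeasurableSet s) (hμ : μ (g ⁻¹' s) ≠ 0) : (μ[|g ⁻¹' s]).map f = μ.map f := by
  ext t ht
  rw [Measure.map_apply hf ht, Measure.map_apply hf ht, cond_apply (hg hs), Set.inter_comm,
    h.measure_inter_preimage_eq_mul _ _ ht hs, mul_comm, mul_assoc,
    ENNReal.mul_inv_cancel hμ (measure_ne_top _ _), mul_one]

lemma integral_cond_of_indepFun {α β γ : Type*} [MeasurableSpace α] [MeasurableSpace β]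
    [MeasurableSpace γ] {μ : Measure α} [IsProbabilityMeasure μ] {f : α → β} {g : α → γ}
    (hf : Measurable f) (hg : Measurable g) (h : IndepFun f g μ) {s : Set γ}
    (hs : MeasurableSet s) (hμ : μ (g ⁻¹' s) ≠ 0) {φ : β → ℝ} (hφ : Measurable φ) :
    ∫ a, φ (f a) ∂(μ[|g ⁻¹' s]) = ∫ a, φ (f a) ∂μ := by
  rw [← integral_map hf.aemeasurable hφ.aestronglyMeasurable,
    map_cond_of_indepFun hf hg h hs hμ,
    integral_map hf.aemeasurable hφ.aestronglyMeasurable]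

lemma integrable_cond {α : Type*} [MeasurableSpace α] {μ : Measure α} {f : α → ℝ} {s : Set α}
    (hf : Integrable f μ) (hμ : μ s ≠ 0) : Integrable f (μ[|s]) :=
  (hf.restrict (s := s)).smul_measure (by simpa using hμ)

namespace Experiment

variable {n p : ℕ} {Ω : Type*} [MeasurableSpace Ω] {D : Experiment n p Ω} {P : Measure Ω}

section Moments

variable {C : ℝ≥0}

lemma FourthMomentsLE.error (h : D.FourthMomentsLE P C) (i : Fin n) :
    Integrable (fun ω => D.ε i ω ^ 4) P ∧ ∫ ω, D.ε i ω ^ 4 ∂P ≤ C :=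
  integrable_pow_four_of_lintegral_le (D.measurable_ε i) (h i).2

lemma FourthMomentsLE.feature (h : D.FourthMomentsLE P C) (i : Fin n) (k : Fin p) :
    Integrable (fun ω => D.X i ω k ^ 4) P ∧ ∫ ω, D.X i ω k ^ 4 ∂P ≤ C :=
  integrable_pow_four_of_lintegral_le (D.measurable_X_apply i k) ((h i).1 k)

variable [IsProbabilityMeasure P]

lemma FourthMomentsLE.regressor (h : D.FourthMomentsLE P C) (i : Fin n) (k : Fin (p + 1)) :
    Integrable (fun ω => D.regressor i ω k ^ 4) P ∧ ∫ ω, D.regressor i ω k ^ 4 ∂P ≤ 1 + C := by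
  refine Fin.cases ?_ (fun k => ?_) k
  · simp [Experiment.regressor]
  · have := h.feature i k
    simp only [Experiment.regressor, Matrix.cons_val_succ]
    exact ⟨this.1, this.2.trans (by simp)⟩

lemma FourthMomentsLE.regressor_mul (h : D.FourthMomentsLE P C) (i : Fin n) (k l : Fin (p + 1)) :
    Integrable (fun ω => (D.regressor i ω k * D.regressor i ω l) ^ 2) P ∧
      ∫ ω, (D.regressor i ω k * D.regressor i ω l) ^ 2 ∂P ≤ 1 + C := by
  have hk := h.regressor i k
  have hl := h.regressor i l
  have hs : Integrable
      (fun ω => (1 / 2 : ℝ) * (D.regressor i ω k ^ 4 + D.regressor i ω l ^ 4)) P :=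
    (hk.1.add hl.1).const_mul _
  have hle : ∀ ω, (D.regressor i ω k * D.regressor i ω l) ^ 2 ≤
      (1 / 2 : ℝ) * (D.regressor i ω k ^ 4 + D.regressor i ω l ^ 4) := fun ω => by
    nlinarith [sq_nonneg (D.regressor i ω k ^ 2 - D.regressor i ω l ^ 2)]
  have hi : Integrable (fun ω => (D.regressor i ω k * D.regressor i ω l) ^ 2) P := by
    refine hs.mono' ?_ (ae_of_all _ fun ω => ?_)
    · exact (((D.measurable_regressor i k).mul
        (D.measurable_regressor i l)).pow_const 2).aestronglyMeasurable
    · rw [Real.norm_eq_abs, abs_of_nonneg (sq_nonneg _)]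
      exact hle ω
  refine ⟨hi, (integral_mono hi hs hle).trans ?_⟩
  rw [integral_const_mul, integral_add hk.1 hl.1]
  linarith [hk.2, hl.2]

lemma FourthMomentsLE.regressor_sq (h : D.FourthMomentsLE P C) (i : Fin n) (k : Fin (p + 1)) :
    Integrable (fun ω => D.regressor i ω k ^ 2) P ∧ ∫ ω, D.regressor i ω k ^ 2 ∂P ≤ 1 + C := by
  have := h.regressor_mul i 0 k
  simpa [Experiment.regressor] using this

lemma FourthMomentsLE.integrable_feature (h : D.FourthMomentsLE P C) (i : Fin n) (k : Fin p) :
    Integrable (fun ω => D.X i ω k) P := by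
  have h2 := (h.regressor_sq i k.succ).1
  have : MemLp (fun ω => D.regressor i ω k.succ) 2 P :=
    (memLp_two_iff_integrable_sq (D.measurable_regressor i k.succ).aestronglyMeasurable).2 h2
  simpa [Experiment.regressor] using this.integrable (by norm_num)

lemma FourthMomentsLE.integral_xbar (h : D.FourthMomentsLE P C) (k : Fin p) :
    ∫ ω, D.xbar ω k ∂P = (1 / (n : ℝ)) * ∑ i, ∫ ω, D.X i ω k ∂P := by
  simp only [xbar]
  rw [integral_const_mul, integral_finsetSum _ fun i _ => h.integrable_feature i k]

lemma measurable_xbar (D : Experiment n p Ω) (k : Fin p) : Measurable fun ω => D.xbar ω k := by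
  simp only [xbar]
  exact (Finset.measurable_sum _ fun i _ => D.measurable_X_apply i k).const_mul _

lemma FourthMomentsLE.xbar_sq (h : D.FourthMomentsLE P C) (k : Fin p) :
    Integrable (fun ω => D.xbar ω k ^ 2) P ∧ ∫ ω, D.xbar ω k ^ 2 ∂P ≤ 1 + C := by
  have hX : ∀ i, Integrable (fun ω => D.X i ω k ^ 2) P ∧ ∫ ω, D.X i ω k ^ 2 ∂P ≤ 1 + C :=
    fun i => by simpa [Experiment.regressor] using h.regressor_sq i k.succ
  have hle : ∀ ω, D.xbar ω k ^ 2 ≤ (1 / (n : ℝ)) * ∑ i, D.X i ω k ^ 2 := by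
    intro ω
    rcases Nat.eq_zero_or_pos n with rfl | hn
    · simp [xbar]
    have hn' : (0 : ℝ) < n := by exact_mod_cast hn
    have := sq_sum_le_card_mul_sum_sq (s := Finset.univ) (f := fun i => D.X i ω k)
    simp only [Finset.card_univ, Fintype.card_fin] at this
    simp only [xbar, mul_pow]
    calc (1 / (n : ℝ)) ^ 2 * (∑ i, D.X i ω k) ^ 2 ≤
        (1 / (n : ℝ)) ^ 2 * (n * ∑ i, D.X i ω k ^ 2) := by gcongr
      _ = _ := by field_simp
  have hs : Integrable (fun ω => (1 / (n : ℝ)) * ∑ i, D.X i ω k ^ 2) P :=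
    (integrable_finsetSum _ fun i _ => (hX i).1).const_mul _
  have hi : Integrable (fun ω => D.xbar ω k ^ 2) P := by
    refine hs.mono' ((measurable_xbar D k).pow_const 2).aestronglyMeasurable
      (ae_of_all _ fun ω => ?_)
    rw [Real.norm_eq_abs, abs_of_nonneg (sq_nonneg _)]
    exact hle ω
  refine ⟨hi, (integral_mono hi hs hle).trans ?_⟩
  rw [integral_const_mul, integral_finsetSum _ fun i _ => (hX i).1]
  rcases Nat.eq_zero_or_pos n with rfl | hn
  · simp; positivity
  have hn' : (0 : ℝ) < n := by exact_mod_cast hn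
  calc (1 / (n : ℝ)) * ∑ i, ∫ ω, D.X i ω k ^ 2 ∂P ≤ (1 / (n : ℝ)) * ∑ _i : Fin n, (1 + C : ℝ) := by
        gcongr with i
        exact (hX i).2
    _ = 1 + C := by simp; field_simp

end Moments

section Design

variable [IsProbabilityMeasure P] {q σ : ℝ}

/-- The probability of arm `w` when the treatment probability is `q`. -/
def _root_.armProb (q : ℝ) (w : Bool) : ℝ := if w then q else 1 - q

lemma Regular.measure_arm (h : D.Regular P q σ) (i : Fin n) (w : Bool) :
    P {ω | D.W i ω = w} = ENNReal.ofReal (armProb q w) := by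
  cases w with
  | true => simpa [armProb] using h.treatments_law i
  | false =>
    have hc : {ω | D.W i ω = false} = {ω | D.W i ω = true}ᶜ := by
      ext ω; simp
    have hm : MeasurableSet {ω | D.W i ω = true} :=
      (D.measurable_W i) (measurableSet_singleton true)
    rw [hc, prob_compl_eq_one_sub hm, h.treatments_law i, ← ENNReal.ofReal_one,
      ← ENNReal.ofReal_sub _ h.prob_pos.le]
    simp [armProb]

lemma Regular.armProb_pos (h : D.Regular P q σ) (w : Bool) : 0 < armProb q w := by
  cases w
  · simpa [armProb] using h.prob_lt_one
  · simpa [armProb] using h.prob_pos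

lemma Regular.armProb_le_one (h : D.Regular P q σ) (w : Bool) : armProb q w ≤ 1 := by
  cases w
  · simpa [armProb] using h.prob_pos.le
  · simpa [armProb] using h.prob_lt_one.le

lemma Regular.measure_all_ne_zero (h : D.Regular P q σ) (w : Bool) :
    P {ω | ∀ j, D.W j ω = w} ≠ 0 := by
  have h1 := h.treatments_indep.measure_inter_preimage_eq_mul Finset.univ (sets := fun _ => {w})
    (fun _ _ => measurableSet_singleton w)
  have h2 : (⋂ i ∈ Finset.univ, D.W i ⁻¹' {w}) = {ω | ∀ j, D.W j ω = w} := by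
    ext ω; simp
  rw [← h2, h1, Finset.prod_ne_zero_iff]
  intro i _
  have h3 := h.measure_arm i w
  have h4 : D.W i ⁻¹' {w} = {ω | D.W i ω = w} := rfl
  rw [h4, h3]
  simpa using h.armProb_pos w

lemma Regular.measure_indirect_ne_zero (h : D.Regular P q σ) (i : Fin n) (w : Bool) :
    P {ω | ∀ j, D.indirect i ω j = w} ≠ 0 := by
  have hsub : {ω | ∀ j, D.W j ω = w} ⊆ {ω | ∀ j, D.indirect i ω j = w} := fun ω hω j => hω j
  exact fun h0 => h.measure_all_ne_zero w (measure_mono_null hsub h0)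

lemma measurable_indirect (D : Experiment n p Ω) (i : Fin n) : Measurable (D.indirect i) :=
  measurable_pi_lambda _ fun j => D.measurable_W j

lemma measurable_treatments (D : Experiment n p Ω) : Measurable D.treatments :=
  measurable_pi_lambda _ fun j => D.measurable_W j

lemma measurable_features (D : Experiment n p Ω) : Measurable D.features :=
  measurable_pi_lambda _ fun j => D.measurable_X j

/-- Static features that are functions of the indirect treatments are almost surely constant, so
in all cases static features are jointly independent of the treatments. -/
lemma Regular.indepFun_features_treatments (h : D.Regular P q σ)
    (hfeat : D.FeaturesOfIndirect P ∨ IndepFun D.features D.treatments P)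
    (hstatic : ∀ i, IndepFun (D.X i) (D.indirect i) P) :
    IndepFun D.features D.treatments P := by
  refine hfeat.elim (fun hf => ?_) id
  have hc : ∀ i, ∃ c : Fin p → ℝ, D.X i =ᵐ[P] fun _ => c := by
    intro i
    obtain ⟨x, hx⟩ := hf i
    refine ⟨x fun _ => true, ?_⟩
    have hm := (hstatic i).measure_inter_preimage_eq_mul _ _
      (measurableSet_singleton (x fun _ => true)).compl
      (measurableSet_singleton fun _ => true)
    have h0 : P (D.X i ⁻¹' {x fun _ => true}ᶜ ∩ D.indirect i ⁻¹' {fun _ => true}) = 0 := by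
      refine measure_mono_null ?_ (ae_iff.1 hx)
      rintro ω ⟨h1, h2⟩ h3
      refine h1 ?_
      rw [Set.mem_preimage, Set.mem_singleton_iff] at h2
      rw [Set.mem_singleton_iff, h3]
      exact congrArg x h2
    rw [h0] at hm
    have h1 : P (D.indirect i ⁻¹' {fun _ => true}) ≠ 0 := by
      have := h.measure_indirect_ne_zero i true
      convert this using 2
      ext ω
      simp [funext_iff]
    exact (mul_eq_zero.1 hm.symm).resolve_right h1
  choose c hc using hc
  have hfc : D.features =ᵐ[P] fun _ => c := by
    filter_upwards [ae_all_iff.2 hc] with ω hω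
    funext i
    exact hω i
  exact (indepFun_const_left c D.treatments).congr hfc.symm ae_eq_rfl

lemma Regular.omega_eq {C : ℝ≥0} (h : D.Regular P q σ) (hm : D.FourthMomentsLE P C)
    (hstatic : ∀ i, IndepFun (D.X i) (D.indirect i) P) (w : Bool) (k : Fin p) :
    D.omega P w k = ∫ ω, D.xbar ω k ∂P := by
  rw [hm.integral_xbar, omega]
  congr 1
  refine Finset.sum_congr rfl fun i _ => ?_
  have hset : {ω | ∀ j, D.indirect i ω j = w} = D.indirect i ⁻¹' {fun _ => w} := by
    ext ω; simp [funext_iff]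
  rw [hset]
  exact integral_cond_of_indepFun (D.measurable_X i) (measurable_indirect D i) (hstatic i)
    (measurableSet_singleton fun _ => w) (hset ▸ h.measure_indirect_ne_zero i w)
    (φ := fun x => x k) (by fun_prop)

lemma Regular.integrable_error (h : D.Regular P q σ) (i : Fin n) : Integrable (D.ε i) P :=
  (h.errors_memLp i).integrable (by norm_num)

lemma Regular.integral_error_cond (h : D.Regular P q σ) (i : Fin n) (w : Bool) :
    ∫ ω, D.ε i ω ∂(P[|{ω | ∀ j, D.W j ω = w}]) = 0 := by
  have hle : D.designSigma ≤ ‹MeasurableSpace Ω› := (D.measurable_design).comap_le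
  have hE : MeasurableSet[D.designSigma] {ω | ∀ j, D.W j ω = w} := by
    refine ⟨{z | z.2 = fun _ => w}, measurable_snd (measurableSet_singleton _), ?_⟩
    ext ω; simp [design, treatments, funext_iff]
  rw [ProbabilityTheory.cond, integral_smul_measure,
    ← setIntegral_condExp hle (h.integrable_error i) hE,
    integral_congr_ae (ae_restrict_of_ae (h.errors_exogenous i))]
  simp

lemma Regular.gate_eq {C : ℝ≥0} (h : D.Regular P q σ) (hm : D.FourthMomentsLE P C)
    (hind : IndepFun D.features D.treatments P) (hn : n ≠ 0) :
    D.gate P = Matrix.vecCons 1 (fun k => ∫ ω, D.xbar ω k ∂P) ⬝ᵥ D.beta true -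
      Matrix.vecCons 1 (fun k => ∫ ω, D.xbar ω k ∂P) ⬝ᵥ D.beta false := by
  have hn' : (n : ℝ) ≠ 0 := by exact_mod_cast hn
  have hY : ∀ i w, ∫ ω, D.Y i ω ∂(P[|{ω | ∀ j, D.W j ω = w}]) =
      D.α w + ∑ k, D.η w k * ∫ ω, D.X i ω k ∂P := by
    intro i w
    have hset : {ω | ∀ j, D.W j ω = w} = D.treatments ⁻¹' {fun _ => w} := by
      ext ω; simp [treatments, funext_iff]
    have hE : MeasurableSet {ω | ∀ j, D.W j ω = w} := by
      rw [hset]; exact measurable_treatments D (measurableSet_singleton _)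
    have hP := h.measure_all_ne_zero w
    have : IsProbabilityMeasure (P[|{ω | ∀ j, D.W j ω = w}]) := cond_isProbabilityMeasure hP
    have hXk : ∀ k, ∫ ω, D.X i ω k ∂(P[|{ω | ∀ j, D.W j ω = w}]) = ∫ ω, D.X i ω k ∂P := by
      intro k
      rw [hset]
      exact integral_cond_of_indepFun (measurable_features D) (measurable_treatments D) hind
        (measurableSet_singleton fun _ => w) (hset ▸ hP) (φ := fun x => x i k) (by fun_prop)
    have hYe : D.Y i =ᵐ[P[|{ω | ∀ j, D.W j ω = w}]]
        fun ω => D.α w + ∑ k, D.η w k * D.X i ω k + D.ε i ω := by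
      filter_upwards [ae_cond_mem hE] with ω hω
      rw [Y, hω i, surface, dotProduct]
    have hXi : ∀ k, Integrable (fun ω => D.η w k * D.X i ω k)
        (P[|{ω | ∀ j, D.W j ω = w}]) := fun k =>
      (integrable_cond (hm.integrable_feature i k) hP).const_mul _
    have hS : Integrable (fun ω => ∑ k, D.η w k * D.X i ω k)
        (P[|{ω | ∀ j, D.W j ω = w}]) := integrable_finsetSum _ fun k _ => hXi k
    rw [integral_congr_ae hYe, integral_add ((integrable_const _).fun_add hS)
      (integrable_cond (h.integrable_error i) hP), integral_add (integrable_const _) hS,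
      h.integral_error_cond, integral_finsetSum _ fun k _ => hXi k]
    simp [integral_const_mul, hXk]
  have hw : ∀ w, (1 / (n : ℝ)) * ∑ i, ∫ ω, D.Y i ω ∂(P[|{ω | ∀ j, D.W j ω = w}]) =
      Matrix.vecCons 1 (fun k => ∫ ω, D.xbar ω k ∂P) ⬝ᵥ D.beta w := by
    intro w
    simp only [hY, Finset.sum_add_distrib, hm.integral_xbar]
    rw [Finset.sum_comm]
    simp only [← Finset.mul_sum]
    simp only [Finset.sum_const, Finset.card_univ, Fintype.card_fin, nsmul_eq_mul, dotProduct,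
      Fin.sum_univ_succ, beta, Matrix.cons_val_zero, Matrix.cons_val_succ, one_mul]
    rw [mul_add, Finset.mul_sum, ← mul_assoc, one_div_mul_cancel hn', one_mul]
    congr 1
    exact Finset.sum_congr rfl fun k _ => by ring
  rw [gate, Finset.sum_sub_distrib, mul_sub, hw, hw]

end Design

end Experiment

namespace Experiment

variable {n p : ℕ} {Ω : Type*} [MeasurableSpace Ω] {D : Experiment n p Ω} {P : Measure Ω}
  [IsProbabilityMeasure P] {q σ : ℝ} {C : ℝ≥0}

/-! ### The conditional law of the errors given the design -/

/-- The regular conditional law of the error vector given the design. -/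
noncomputable abbrev errorKernel (D : Experiment n p Ω) (P : Measure Ω) [IsProbabilityMeasure P] :
    Kernel ((Fin n → Fin p → ℝ) × (Fin n → Bool)) (Fin n → ℝ) :=
  condDistrib D.errors D.design P

lemma ae_integral_errorKernel_eq {f : (Fin n → ℝ) → ℝ} (hf : Measurable f)
    (hfi : Integrable (fun ω => f (D.errors ω)) P) {c : ℝ}
    (h : P[fun ω => f (D.errors ω) | D.designSigma] =ᵐ[P] fun _ => c) :
    ∀ᵐ z ∂(P.map D.design), ∫ e, f e ∂(D.errorKernel P z) = c := by
  have hm : StronglyMeasurable fun z => ∫ e, f e ∂(D.errorKernel P z) :=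
    StronglyMeasurable.integral_condDistrib (f := fun x : _ × (Fin n → ℝ) => f x.2)
      (hf.comp measurable_snd).stronglyMeasurable
  rw [ae_map_iff D.measurable_design.aemeasurable
    (measurableSet_eq_fun hm.measurable measurable_const)]
  exact (condExp_ae_eq_integral_condDistrib D.measurable_design D.measurable_errors.aemeasurable
    hf.stronglyMeasurable hfi).symm.trans h

lemma Regular.ae_integral_error (h : D.Regular P q σ) :
    ∀ᵐ z ∂(P.map D.design), ∀ i, ∫ e, e i ∂(D.errorKernel P z) = 0 :=
  ae_all_iff.2 fun i => ae_integral_errorKernel_eq (measurable_pi_apply i)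
    (h.integrable_error i) (h.errors_exogenous i)

lemma Regular.ae_integral_error_sq (h : D.Regular P q σ) :
    ∀ᵐ z ∂(P.map D.design), ∀ i, ∫ e, e i ^ 2 ∂(D.errorKernel P z) = σ ^ 2 := by
  refine ae_all_iff.2 fun i => ae_integral_errorKernel_eq
    (f := fun e => e i ^ 2) ((measurable_pi_apply i).pow_const 2)
    (h.errors_memLp i).integrable_sq ?_
  have hv := condVar_ae_eq_condExp_sq_sub_sq_condExp D.measurable_design.comap_le
    (h.errors_memLp i)
  filter_upwards [hv, h.errors_homoscedastic i, h.errors_exogenous i] with ω h1 h2 h3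
  rw [h2] at h1
  simp only [Pi.sub_apply, Pi.pow_apply, h3] at h1
  have h4 : σ ^ 2 = (P[D.ε i ^ 2 | D.designSigma]) ω := by simpa using h1
  exact h4.symm

lemma map_design_errors (D : Experiment n p Ω) (P : Measure Ω) [IsProbabilityMeasure P] :
    P.map (fun ω => (D.design ω, D.errors ω)) = (P.map D.design) ⊗ₘ D.errorKernel P :=
  (compProd_map_condDistrib D.measurable_errors.aemeasurable).symm

instance : IsProbabilityMeasure (P.map D.design) :=
  Measure.isProbabilityMeasure_map D.measurable_design.aemeasurable

lemma integrable_compProd_error_four (hm : D.FourthMomentsLE P C) (i : Fin n) :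
    Integrable (fun x => x.2 i ^ 4) ((P.map D.design) ⊗ₘ D.errorKernel P) := by
  rw [← map_design_errors, integrable_map_measure]
  · exact (hm.error i).1
  · exact (by fun_prop : Measurable fun x :
      ((Fin n → Fin p → ℝ) × (Fin n → Bool)) × (Fin n → ℝ) => x.2 i ^ 4).aestronglyMeasurable
  · exact (D.measurable_design.prodMk D.measurable_errors).aemeasurable

lemma FourthMomentsLE.ae_integrable_error_four (hm : D.FourthMomentsLE P C) :
    ∀ᵐ z ∂(P.map D.design), ∀ i, Integrable (fun e => e i ^ 4) (D.errorKernel P z) :=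
  ae_all_iff.2 fun i =>
    ((Measure.integrable_compProd_iff (integrable_compProd_error_four hm i).1).1
      (integrable_compProd_error_four hm i)).1

lemma FourthMomentsLE.integral_error_four (hm : D.FourthMomentsLE P C) (i : Fin n) :
    Integrable (fun z => ∫ e, e i ^ 4 ∂(D.errorKernel P z)) (P.map D.design) ∧
    ∫ z, ∫ e, e i ^ 4 ∂(D.errorKernel P z) ∂(P.map D.design) ≤ C := by
  have h := integrable_compProd_error_four (D := D) hm i
  refine ⟨h.integral_compProd, ?_⟩
  rw [← Measure.integral_compProd h, ← map_design_errors, integral_map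
    (D.measurable_design.prodMk D.measurable_errors).aemeasurable]
  · exact (hm.error i).2
  · rw [map_design_errors]; exact h.1

/-- Second moment of a linear combination of the errors whose coefficients depend on the design. -/
lemma Regular.integral_sq_sum_mul_error (h : D.Regular P q σ) (hm : D.FourthMomentsLE P C)
    {c : (Fin n → Fin p → ℝ) × (Fin n → Bool) → Fin n → ℝ} (hc : ∀ i, Measurable fun z => c z i)
    (hci : ∀ i, Integrable (fun ω => c (D.design ω) i ^ 2) P) :
    Integrable (fun ω => (∑ i, c (D.design ω) i * D.ε i ω) ^ 2) P ∧
      ∫ ω, (∑ i, c (D.design ω) i * D.ε i ω) ^ 2 ∂P =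
        σ ^ 2 * ∑ i, ∫ ω, c (D.design ω) i ^ 2 ∂P := by
  have hFm : Measurable fun x : ((Fin n → Fin p → ℝ) × (Fin n → Bool)) × (Fin n → ℝ) =>
      (∑ i, c x.1 i * x.2 i) ^ 2 := by
    refine (Finset.measurable_sum _ fun i _ => ?_).pow_const 2
    exact ((hc i).comp measurable_fst).mul ((measurable_pi_apply i).comp measurable_snd)
  have hinner : ∀ᵐ z ∂(P.map D.design),
      ∫⁻ e, ENNReal.ofReal ((∑ i, c z i * e i) ^ 2) ∂(D.errorKernel P z) =
        ENNReal.ofReal (σ ^ 2 * ∑ i, c z i ^ 2) := by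
    filter_upwards [h.ae_integral_error, h.ae_integral_error_sq, hm.ae_integrable_error_four,
      h.errors_indep] with z h0 h2 h4 hind
    have hL : ∀ i, MemLp (fun e : Fin n → ℝ => e i) 2 (D.errorKernel P z) := by
      intro i
      refine (memLp_two_iff_integrable_sq
        (measurable_pi_apply i).aestronglyMeasurable).2 ?_
      refine ((integrable_const (1 : ℝ)).add (h4 i)).mono'
        ((measurable_pi_apply i).pow_const 2).aestronglyMeasurable (ae_of_all _ fun e => ?_)
      simp only [norm_pow, Real.norm_eq_abs, sq_abs, Pi.add_apply]
      nlinarith [sq_nonneg (e i ^ 2 - 1), sq_nonneg (e i ^ 2)]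
    have hLc : ∀ i, MemLp (fun e : Fin n → ℝ => c z i * e i) 2 (D.errorKernel P z) :=
      fun i => (hL i).const_mul _
    have hLs : MemLp (fun e : Fin n → ℝ => ∑ i, c z i * e i) 2 (D.errorKernel P z) :=
      memLp_finsetSum _ fun i _ => hLc i
    have hmean : ∀ i, ∫ e, c z i * e i ∂(D.errorKernel P z) = 0 := fun i => by
      rw [integral_const_mul, h0 i, mul_zero]
    have hvar := IndepFun.variance_sum (s := Finset.univ)
      (X := fun i (e : Fin n → ℝ) => c z i * e i) (fun i _ => hLc i)
      (fun i _ j _ hij => (hind.indepFun hij).comp (measurable_const_mul (c z i))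
        (measurable_const_mul (c z j)))
    have hsum : (∑ i, fun e : Fin n → ℝ => c z i * e i) = fun e => ∑ i, c z i * e i := by
      funext e; simp
    rw [hsum, variance_of_integral_eq_zero hLs.aemeasurable] at hvar
    · rw [← ofReal_integral_eq_lintegral_ofReal hLs.integrable_sq
        (ae_of_all _ fun e => sq_nonneg _), hvar, Finset.mul_sum]
      congr 1
      refine Finset.sum_congr rfl fun i _ => ?_
      rw [variance_of_integral_eq_zero (hLc i).aemeasurable (hmean i)]
      simp only [mul_pow, integral_const_mul, h2 i]
      ring
    · rw [integral_finsetSum _ fun i _ => (hLc i).integrable (by norm_num)]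
      simp [hmean]
  have hkey : ∫⁻ ω, ENNReal.ofReal ((∑ i, c (D.design ω) i * D.ε i ω) ^ 2) ∂P =
      ENNReal.ofReal (σ ^ 2 * ∑ i, ∫ ω, c (D.design ω) i ^ 2 ∂P) := by
    calc ∫⁻ ω, ENNReal.ofReal ((∑ i, c (D.design ω) i * D.ε i ω) ^ 2) ∂P
        = ∫⁻ x, ENNReal.ofReal ((∑ i, c x.1 i * x.2 i) ^ 2)
            ∂(P.map fun ω => (D.design ω, D.errors ω)) :=
          (lintegral_map hFm.ennreal_ofReal
            (D.measurable_design.prodMk D.measurable_errors)).symm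
      _ = ∫⁻ z, ∫⁻ e, ENNReal.ofReal ((∑ i, c z i * e i) ^ 2) ∂(D.errorKernel P z)
            ∂(P.map D.design) := by
          rw [map_design_errors, Measure.lintegral_compProd hFm.ennreal_ofReal]
      _ = ∫⁻ z, ENNReal.ofReal (σ ^ 2 * ∑ i, c z i ^ 2) ∂(P.map D.design) :=
          lintegral_congr_ae hinner
      _ = ∫⁻ ω, ENNReal.ofReal (σ ^ 2 * ∑ i, c (D.design ω) i ^ 2) ∂P := by
          rw [lintegral_map _ D.measurable_design]
          exact ((Finset.measurable_sum _ fun i _ => (hc i).pow_const 2).const_mul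
            _).ennreal_ofReal
      _ = _ := by
          rw [← ofReal_integral_eq_lintegral_ofReal
            ((integrable_finsetSum _ fun i _ => hci i).const_mul _)
            (ae_of_all _ fun ω => mul_nonneg (sq_nonneg _)
              (Finset.sum_nonneg fun i _ => sq_nonneg _)),
            integral_const_mul, integral_finsetSum _ fun i _ => hci i]
  have hmeas : Measurable fun ω => (∑ i, c (D.design ω) i * D.ε i ω) ^ 2 :=
    hFm.comp (D.measurable_design.prodMk D.measurable_errors)
  refine ⟨⟨hmeas.aestronglyMeasurable, ?_⟩, ?_⟩
  · rw [hasFiniteIntegral_iff_ofReal (ae_of_all _ fun ω => sq_nonneg _), hkey]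
    exact ENNReal.ofReal_lt_top
  · rw [integral_eq_lintegral_of_nonneg_ae (ae_of_all _ fun ω => sq_nonneg _)
      hmeas.aestronglyMeasurable, hkey, ENNReal.toReal_ofReal]
    exact mul_nonneg (sq_nonneg _)
      (Finset.sum_nonneg fun i _ => integral_nonneg fun ω => sq_nonneg _)

/-- Gaussian approximation of the characteristic function of a linear combination of the errors
whose coefficients depend on the design. -/
lemma Regular.norm_charFun_sub_le (h : D.Regular P q σ) (hm : D.FourthMomentsLE P C)
    {c : (Fin n → Fin p → ℝ) × (Fin n → Bool) → Fin n → ℝ} (hc : ∀ i, Measurable fun z => c z i)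
    {b : ℝ} (hb : ∀ z i, |c z i| ≤ b) :
    ‖∫ ω, Complex.exp ((∑ i, c (D.design ω) i * D.ε i ω : ℝ) * Complex.I) ∂P -
      (∫ ω, Real.exp (-(σ ^ 2 / 2 * ∑ i, c (D.design ω) i ^ 2)) ∂P : ℝ)‖ ≤
      n * (4 * b ^ 3 * (1 + C) + b ^ 4 * σ ^ 4) := by
  have hFm : Measurable fun x : ((Fin n → Fin p → ℝ) × (Fin n → Bool)) × (Fin n → ℝ) =>
      Complex.exp ((∑ i, c x.1 i * x.2 i : ℝ) * Complex.I) := by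
    have : Measurable fun x : ((Fin n → Fin p → ℝ) × (Fin n → Bool)) × (Fin n → ℝ) =>
        (∑ i, c x.1 i * x.2 i : ℝ) := Finset.measurable_sum _ fun i _ =>
      ((hc i).comp measurable_fst).mul ((measurable_pi_apply i).comp measurable_snd)
    fun_prop
  have hGm : Measurable fun z : (Fin n → Fin p → ℝ) × (Fin n → Bool) =>
      Real.exp (-(σ ^ 2 / 2 * ∑ i, c z i ^ 2)) :=
    ((Finset.measurable_sum _ fun i _ => (hc i).pow_const 2).const_mul _).neg.exp
  have hFi : Integrable (fun x => Complex.exp ((∑ i, c x.1 i * x.2 i : ℝ) * Complex.I))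
      ((P.map D.design) ⊗ₘ D.errorKernel P) :=
    Integrable.of_bound hFm.aestronglyMeasurable 1
      (ae_of_all _ fun x => by rw [Complex.norm_exp_ofReal_mul_I])
  have hG1 : ∀ z, Real.exp (-(σ ^ 2 / 2 * ∑ i, c z i ^ 2)) ≤ 1 := fun z => by
    rw [Real.exp_le_one_iff, neg_nonpos]
    exact mul_nonneg (by positivity) (Finset.sum_nonneg fun i _ => sq_nonneg _)
  have hGi : Integrable (fun z => ((Real.exp (-(σ ^ 2 / 2 * ∑ i, c z i ^ 2)) : ℝ) : ℂ))
      (P.map D.design) :=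
    (Integrable.of_bound hGm.aestronglyMeasurable 1
      (ae_of_all _ fun z => by
        rw [Real.norm_eq_abs, abs_of_pos (Real.exp_pos _)]; exact hG1 z)).ofReal
  have e1 : ∫ ω, Complex.exp ((∑ i, c (D.design ω) i * D.ε i ω : ℝ) * Complex.I) ∂P =
      ∫ z, ∫ e, Complex.exp ((∑ i, c z i * e i : ℝ) * Complex.I) ∂(D.errorKernel P z)
        ∂(P.map D.design) := by
    rw [← Measure.integral_compProd hFi, ← map_design_errors]
    exact (integral_map (D.measurable_design.prodMk D.measurable_errors).aemeasurable
      hFm.aestronglyMeasurable).symm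
  have e2 : ((∫ ω, Real.exp (-(σ ^ 2 / 2 * ∑ i, c (D.design ω) i ^ 2)) ∂P : ℝ) : ℂ) =
      ∫ z, ((Real.exp (-(σ ^ 2 / 2 * ∑ i, c z i ^ 2)) : ℝ) : ℂ) ∂(P.map D.design) := by
    rw [integral_complex_ofReal]
    congr 1
    exact (integral_map D.measurable_design.aemeasurable hGm.aestronglyMeasurable).symm
  have hFi' : Integrable (fun z => ∫ e, Complex.exp ((∑ i, c z i * e i : ℝ) * Complex.I)
      ∂(D.errorKernel P z)) (P.map D.design) := hFi.integral_compProd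
  rw [e1, e2, ← integral_sub hFi' hGi]
  have hbound : ∀ᵐ z ∂(P.map D.design),
      ‖∫ e, Complex.exp ((∑ i, c z i * e i : ℝ) * Complex.I) ∂(D.errorKernel P z) -
        ((Real.exp (-(σ ^ 2 / 2 * ∑ i, c z i ^ 2)) : ℝ) : ℂ)‖ ≤
      ∑ i, (4 * b ^ 3 * (1 + ∫ e, e i ^ 4 ∂(D.errorKernel P z)) + b ^ 4 * σ ^ 4) := by
    filter_upwards [h.ae_integral_error, h.ae_integral_error_sq, hm.ae_integrable_error_four,
      h.errors_indep] with z h0 h2 h4 hind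
    have f1 : ∫ e, Complex.exp ((∑ i, c z i * e i : ℝ) * Complex.I) ∂(D.errorKernel P z) =
        ∏ i, ∫ e, Complex.exp ((c z i * e i : ℝ) * Complex.I) ∂(D.errorKernel P z) := by
      rw [← hind.integral_fun_prod_comp (f := fun i x => Complex.exp ((c z i * x : ℝ) * Complex.I))
        (fun i => (measurable_pi_apply i).aemeasurable)
        (fun i => by fun_prop)]
      congr 1
      funext e
      rw [← Complex.exp_sum]
      push_cast
      rw [Finset.sum_mul]
    have f2 : ((Real.exp (-(σ ^ 2 / 2 * ∑ i, c z i ^ 2)) : ℝ) : ℂ) =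
        ∏ i, ((Real.exp (-(c z i ^ 2 * σ ^ 2 / 2)) : ℝ) : ℂ) := by
      rw [← Complex.ofReal_prod, ← Real.exp_sum]
      congr 2
      rw [Finset.sum_neg_distrib, Finset.mul_sum]
      congr 1
      exact Finset.sum_congr rfl fun i _ => by ring
    rw [f1, f2]
    refine (norm_prod_sub_prod_le_sum _ _ _ (fun i _ => ?_) fun i _ => ?_).trans
      (Finset.sum_le_sum fun i _ => ?_)
    · refine (norm_integral_le_of_norm_le_const (C := 1) (ae_of_all _ fun e => ?_)).trans
        (by simp)
      rw [Complex.norm_exp_ofReal_mul_I]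
    · rw [Complex.norm_real, Real.norm_eq_abs, abs_of_pos (Real.exp_pos _),
        Real.exp_le_one_iff, neg_nonpos]
      positivity
    · refine (norm_integral_exp_sub_exp_le (measurable_pi_apply i) (h4 i) (h0 i) (h2 i) _).trans ?_
      have hI : 0 ≤ ∫ e, e i ^ 4 ∂(D.errorKernel P z) :=
        integral_nonneg fun e => by positivity
      have hci := hb z i
      have h4' : c z i ^ 4 = |c z i| ^ 4 := by rw [← abs_pow, abs_of_nonneg (by positivity)]
      rw [h4']
      gcongr
  have hint : ∀ i, Integrable (fun z => 4 * b ^ 3 * (1 + ∫ e, e i ^ 4 ∂(D.errorKernel P z)) +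
      b ^ 4 * σ ^ 4) (P.map D.design) := fun i =>
    (((integrable_const _).add (hm.integral_error_four i).1).const_mul _).add (integrable_const _)
  refine (norm_integral_le_of_norm_le (integrable_finsetSum _ fun i _ => hint i) hbound).trans ?_
  rw [integral_finsetSum _ fun i _ => hint i]
  calc _ ≤ ∑ _i : Fin n, (4 * b ^ 3 * (1 + C) + b ^ 4 * σ ^ 4) := by
        refine Finset.sum_le_sum fun i _ => ?_
        have hb0 : 0 ≤ b := (abs_nonneg _).trans (hb (fun _ _ => 0, fun _ => true) i)
        rw [integral_add (((integrable_const _).fun_add (hm.integral_error_four i).1).const_mul _)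
          (integrable_const _), integral_const_mul,
          integral_add (integrable_const _) (hm.integral_error_four i).1]
        have := (hm.integral_error_four i).2
        simp only [integral_const, probReal_univ, smul_eq_mul, one_mul]
        gcongr
    _ = _ := by simp [mul_add]

end Experiment

namespace Experiment

section Concentration

variable {n p : ℕ} {Ω : Type*} [MeasurableSpace Ω] {D : Experiment n p Ω} {P : Measure Ω}
  [IsProbabilityMeasure P] {q σ : ℝ} {C : ℝ≥0}

lemma abs_armInd_le (D : Experiment n p Ω) (w : Bool) (i : Fin n) (ω : Ω) :
    |D.armInd w i ω| ≤ 1 := by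
  unfold armInd; split_ifs <;> simp

lemma Regular.integral_armInd (h : D.Regular P q σ) (w : Bool) (i : Fin n) :
    ∫ ω, D.armInd w i ω ∂P = armProb q w := by
  have hm : MeasurableSet {ω | D.W i ω = w} := (D.measurable_W i) (measurableSet_singleton w)
  have he : D.armInd w i = {ω | D.W i ω = w}.indicator fun _ => 1 := by
    funext ω
    by_cases hw : D.W i ω = w <;> simp [armInd, hw]
  rw [he, integral_indicator_const _ hm, measureReal_def, h.measure_arm,
    ENNReal.toReal_ofReal (h.armProb_pos w).le]
  simp

lemma Regular.abs_armInd_sub_le (h : D.Regular P q σ) (w : Bool) (i : Fin n) (ω : Ω) :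
    |D.armInd w i ω - armProb q w| ≤ 1 := by
  have h0 := h.armProb_pos w
  have h1 := h.armProb_le_one w
  unfold armInd
  rw [abs_le]
  split_ifs <;> constructor <;> linarith

lemma integrable_armInd (D : Experiment n p Ω) (w : Bool) (i : Fin n) :
    Integrable (D.armInd w i) P :=
  Integrable.of_bound (D.measurable_armInd w i).aestronglyMeasurable 1
    (ae_of_all _ fun ω => D.abs_armInd_le w i ω)

lemma Regular.integral_centered_mul_centered (h : D.Regular P q σ) (w : Bool) {i j : Fin n}
    (hij : i ≠ j) :
    ∫ ω, (D.armInd w i ω - armProb q w) * (D.armInd w j ω - armProb q w) ∂P = 0 := by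
  have hφ : Measurable fun b : Bool => (if b = w then (1 : ℝ) else 0) - armProb q w :=
    measurable_of_countable _
  have hind := (h.treatments_indep.indepFun hij).comp hφ hφ
  have hz : ∀ i, ∫ ω, (D.armInd w i ω - armProb q w) ∂P = 0 := fun i => by
    rw [integral_sub (D.integrable_armInd w i) (integrable_const _), h.integral_armInd]
    simp
  have := hind.integral_fun_mul_eq_mul_integral
    (hφ.comp (D.measurable_W i)).aestronglyMeasurable
    (hφ.comp (D.measurable_W j)).aestronglyMeasurable
  refine this.trans ?_
  have h0 := hz i
  simp only [armInd] at h0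
  simp only [Function.comp_def, h0, zero_mul]

/-- Concentration of the arm averages of a function of the features. -/
lemma Regular.integral_sq_centered_le (h : D.Regular P q σ)
    (hind : IndepFun D.features D.treatments P) (w : Bool)
    {g : Fin n → (Fin n → Fin p → ℝ) → ℝ} (hg : ∀ i, Measurable (g i)) {K : ℝ}
    (hgi : ∀ i, Integrable (fun ω => g i (D.features ω) ^ 2) P)
    (hgK : ∀ i, ∫ ω, g i (D.features ω) ^ 2 ∂P ≤ K) :
    Integrable (fun ω => ((1 / (n : ℝ)) *
      ∑ i, (D.armInd w i ω - armProb q w) * g i (D.features ω)) ^ 2) P ∧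
    ∫ ω, ((1 / (n : ℝ)) *
      ∑ i, (D.armInd w i ω - armProb q w) * g i (D.features ω)) ^ 2 ∂P ≤ K / n := by
  have hgm : ∀ i, Measurable fun ω => g i (D.features ω) := fun i =>
    (hg i).comp (measurable_features D)
  have hVm : ∀ i, Measurable fun ω => D.armInd w i ω - armProb q w := fun i =>
    (D.measurable_armInd w i).sub_const _
  have hL : ∀ i, MemLp (fun ω => g i (D.features ω)) 2 P := fun i =>
    (memLp_two_iff_integrable_sq (hgm i).aestronglyMeasurable).2 (hgi i)
  have hgg : ∀ i j, Integrable (fun ω => g i (D.features ω) * g j (D.features ω)) P :=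
    fun i j => (hL i).integrable_mul (hL j)
  have hVb : ∀ i j ω, |(D.armInd w i ω - armProb q w) * (D.armInd w j ω - armProb q w)| ≤ 1 := by
    intro i j ω
    rw [abs_mul]
    exact mul_le_one₀ (h.abs_armInd_sub_le w i ω) (abs_nonneg _) (h.abs_armInd_sub_le w j ω)
  have hint : ∀ i j, Integrable (fun ω =>
      ((D.armInd w i ω - armProb q w) * (D.armInd w j ω - armProb q w)) *
        (g i (D.features ω) * g j (D.features ω))) P := fun i j =>
    (hgg i j).bdd_mul ((hVm i).mul (hVm j)).aestronglyMeasurable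
      (ae_of_all _ fun ω => hVb i j ω)
  have hprod : ∀ i j, ∫ ω, ((D.armInd w i ω - armProb q w) * (D.armInd w j ω - armProb q w)) *
      (g i (D.features ω) * g j (D.features ω)) ∂P =
      (∫ ω, (D.armInd w i ω - armProb q w) * (D.armInd w j ω - armProb q w) ∂P) *
        ∫ ω, g i (D.features ω) * g j (D.features ω) ∂P := by
    intro i j
    have hφ : Measurable fun b : Fin n → Bool => ((if b i = w then (1 : ℝ) else 0) - armProb q w) *
        ((if b j = w then (1 : ℝ) else 0) - armProb q w) := measurable_of_countable _
    have := hind.symm.comp hφ ((hg i).mul (hg j))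
    exact this.integral_fun_mul_eq_mul_integral
      (hφ.comp (measurable_treatments D)).aestronglyMeasurable
      (((hg i).mul (hg j)).comp (measurable_features D)).aestronglyMeasurable
  have hexp : ∀ ω, ((1 / (n : ℝ)) *
      ∑ i, (D.armInd w i ω - armProb q w) * g i (D.features ω)) ^ 2 = (1 / (n : ℝ)) ^ 2 *
      ∑ i, ∑ j, ((D.armInd w i ω - armProb q w) * (D.armInd w j ω - armProb q w)) *
        (g i (D.features ω) * g j (D.features ω)) := by
    intro ω
    rw [mul_pow, sq (∑ i, _), Finset.sum_mul_sum]
    congr 1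
    exact Finset.sum_congr rfl fun i _ => Finset.sum_congr rfl fun j _ => by ring
  simp only [hexp]
  have hint' : ∀ i, Integrable (fun ω => ∑ j,
      ((D.armInd w i ω - armProb q w) * (D.armInd w j ω - armProb q w)) *
        (g i (D.features ω) * g j (D.features ω))) P := fun i =>
    integrable_finsetSum _ fun j _ => hint i j
  refine ⟨(integrable_finsetSum _ fun i _ => hint' i).const_mul _, ?_⟩
  rw [integral_const_mul, integral_finsetSum _ fun i _ => hint' i]
  have hdiag : ∀ i, ∫ ω, ∑ j, ((D.armInd w i ω - armProb q w) * (D.armInd w j ω - armProb q w)) *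
      (g i (D.features ω) * g j (D.features ω)) ∂P ≤ K := by
    intro i
    rw [integral_finsetSum _ fun j _ => hint i j, Finset.sum_eq_single i]
    · refine le_trans ?_ (hgK i)
      refine integral_mono (hint i i) (hgi i) fun ω => ?_
      have h1 := (abs_le.1 (hVb i i ω)).2
      have h2 : 0 ≤ g i (D.features ω) * g i (D.features ω) := mul_self_nonneg _
      simp only [sq]
      nlinarith
    · intro j _ hj
      rw [hprod, h.integral_centered_mul_centered w hj.symm, zero_mul]
    · simp
  rcases Nat.eq_zero_or_pos n with rfl | hn
  · simp
  have hn' : (0 : ℝ) < n := by exact_mod_cast hn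
  calc _ ≤ (1 / (n : ℝ)) ^ 2 * ∑ _i : Fin n, K := by
        gcongr with i
        exact hdiag i
    _ = K / n := by simp; field_simp

/-- The regressors as functions of the whole array of features. -/
def regressorOf (i : Fin n) (k : Fin (p + 1)) (x : Fin n → Fin p → ℝ) : ℝ :=
  (Matrix.vecCons 1 (x i) : Fin (p + 1) → ℝ) k

lemma measurable_regressorOf (i : Fin n) (k : Fin (p + 1)) :
    Measurable (regressorOf (p := p) i k) := by
  refine Fin.cases ?_ (fun k => ?_) k
  · exact measurable_const
  · exact (by fun_prop : Measurable fun x : Fin n → Fin p → ℝ => x i k)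

lemma Regular.integral_sq_gram_sub_le (h : D.Regular P q σ) (hm : D.FourthMomentsLE P C)
    (hind : IndepFun D.features D.treatments P) (w : Bool) (k l : Fin (p + 1)) :
    Integrable (fun ω => ((1 / (n : ℝ)) * ∑ i, (D.armInd w i ω - armProb q w) *
      (D.regressor i ω k * D.regressor i ω l)) ^ 2) P ∧
    ∫ ω, ((1 / (n : ℝ)) * ∑ i, (D.armInd w i ω - armProb q w) *
      (D.regressor i ω k * D.regressor i ω l)) ^ 2 ∂P ≤ (1 + (C : ℝ)) / n :=
  h.integral_sq_centered_le hind w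
    (g := fun i x => regressorOf i k x * regressorOf i l x)
    (fun i => (measurable_regressorOf i k).mul (measurable_regressorOf i l))
    (fun i => (hm.regressor_mul i k l).1) (fun i => (hm.regressor_mul i k l).2)

/-- The arm indicators as functions of the design. -/
def armIndOf (w : Bool) (i : Fin n) (z : (Fin n → Fin p → ℝ) × (Fin n → Bool)) : ℝ :=
  if z.2 i = w then 1 else 0

lemma measurable_armIndOf (w : Bool) (i : Fin n) : Measurable (armIndOf (p := p) w i) :=
  (measurable_of_countable fun b : Bool => if b = w then (1 : ℝ) else 0).comp
    ((measurable_pi_apply i).comp measurable_snd)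

lemma Regular.integral_sq_score_le (h : D.Regular P q σ) (hm : D.FourthMomentsLE P C)
    (w : Bool) (k : Fin (p + 1)) :
    Integrable (fun ω => ((√(n : ℝ))⁻¹ * D.score w ω k) ^ 2) P ∧
      ∫ ω, ((√(n : ℝ))⁻¹ * D.score w ω k) ^ 2 ∂P ≤ σ ^ 2 * (1 + C) := by
  have hle : ∀ i ω, (D.armInd w i ω * D.regressor i ω k) ^ 2 ≤ D.regressor i ω k ^ 2 := by
    intro i ω
    unfold armInd
    split_ifs
    · simp
    · simp [sq_nonneg]
  have hi : ∀ i, Integrable (fun ω => (D.armInd w i ω * D.regressor i ω k) ^ 2) P := by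
    intro i
    refine (hm.regressor_sq i k).1.mono' (((D.measurable_armInd w i).mul
      (D.measurable_regressor i k)).pow_const 2).aestronglyMeasurable (ae_of_all _ fun ω => ?_)
    rw [Real.norm_eq_abs, abs_of_nonneg (sq_nonneg _)]
    exact hle i ω
  have hs := h.integral_sq_sum_mul_error hm
    (c := fun z i => armIndOf w i z * regressorOf i k z.1)
    (fun i => (measurable_armIndOf w i).mul ((measurable_regressorOf i k).comp measurable_fst)) hi
  have he : ∀ ω, ((√(n : ℝ))⁻¹ * D.score w ω k) ^ 2 = (n : ℝ)⁻¹ *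
      (∑ i, (armIndOf w i (D.design ω) * regressorOf i k (D.design ω).1) * D.ε i ω) ^ 2 := by
    intro ω
    rw [mul_pow, inv_pow, Real.sq_sqrt (Nat.cast_nonneg n)]
    congr 2
    exact Finset.sum_congr rfl fun i _ => (mul_assoc _ _ _).symm
  simp only [he]
  refine ⟨hs.1.const_mul _, ?_⟩
  rw [integral_const_mul, hs.2]
  have hb : ∀ i, ∫ ω, (armIndOf w i (D.design ω) * regressorOf i k (D.design ω).1) ^ 2 ∂P ≤
      1 + C := fun i =>
    (integral_mono (hi i) (hm.regressor_sq i k).1 (hle i)).trans (hm.regressor_sq i k).2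
  rcases Nat.eq_zero_or_pos n with rfl | hn
  · simp; positivity
  have hn' : (0 : ℝ) < n := by exact_mod_cast hn
  calc _ ≤ (n : ℝ)⁻¹ * (σ ^ 2 * ∑ _i : Fin n, (1 + C : ℝ)) := by
        gcongr with i
        exact hb i
    _ = σ ^ 2 * (1 + C) := by simp; field_simp

end Concentration

end Experiment

section Limits

variable {p : ℕ} {Ω : ℕ → Type*} [∀ n, MeasurableSpace (Ω n)] {P : ∀ n, Measure (Ω n)}
  [∀ n, IsProbabilityMeasure (P n)]

lemma norm_exp_sub_exp_le (a b : ℝ) :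
    ‖Complex.exp (a * Complex.I) - Complex.exp (b * Complex.I)‖ ≤ |a - b| := by
  have h : Complex.exp (a * Complex.I) - Complex.exp (b * Complex.I) =
      Complex.exp (b * Complex.I) * (Complex.exp (Complex.I * ((a - b : ℝ) : ℂ)) - 1) := by
    rw [mul_sub, ← Complex.exp_add, mul_one]
    congr 2
    push_cast; ring
  rw [h, norm_mul, Complex.norm_exp_ofReal_mul_I, one_mul]
  exact Real.norm_exp_I_mul_ofReal_sub_one_le

/-- Convergence in distribution from convergence of the characteristic functions of an
approximation in probability, on varying probability spaces. -/
lemma tendstoInDistribution_of_tendsto_charFun {S T : ∀ n, Ω n → ℝ} {ν : Measure ℝ}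
    [IsProbabilityMeasure ν] (hS : ∀ n, Measurable (S n)) (hT : ∀ n, Measurable (T n))
    (hST : Tendsto (fun x : Σ n, Ω n => S x.1 x.2 - T x.1 x.2) (whp P) (𝓝 0))
    (hchar : ∀ t : ℝ, Tendsto (fun n => ∫ ω, Complex.exp ((t * T n ω : ℝ) * Complex.I) ∂(P n))
      atTop (𝓝 (charFun ν t))) :
    TendstoInDistribution S atTop id P ν where
  forall_aemeasurable n := (hS n).aemeasurable
  tendsto := by
    refine ProbabilityMeasure.tendsto_iff_tendsto_charFun.2 fun t => ?_
    have hν : charFun (Measure.map id ν) t = charFun ν t := by rw [Measure.map_id]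
    have hmap : ∀ n, charFun ((P n).map (S n)) t =
        ∫ ω, Complex.exp ((t * S n ω : ℝ) * Complex.I) ∂(P n) := by
      intro n
      rw [charFun_apply_real, integral_map (hS n).aemeasurable (by fun_prop)]
      simp
    simp only [ProbabilityMeasure.coe_mk, hν, hmap]
    have hei : ∀ (U : ∀ n, Ω n → ℝ), (∀ n, Measurable (U n)) → ∀ n,
        Integrable (fun ω => Complex.exp ((t * U n ω : ℝ) * Complex.I)) (P n) := by
      intro U hU n
      have := hU n
      exact Integrable.of_bound (by fun_prop) 1
        (ae_of_all _ fun ω => by rw [Complex.norm_exp_ofReal_mul_I])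
    have hdiff : Tendsto (fun n => ∫ ω, ‖Complex.exp ((t * S n ω : ℝ) * Complex.I) -
        Complex.exp ((t * T n ω : ℝ) * Complex.I)‖ ∂(P n)) atTop (𝓝 0) := by
      have hmeas : ∀ n, Measurable fun ω => ‖Complex.exp ((t * S n ω : ℝ) * Complex.I) -
          Complex.exp ((t * T n ω : ℝ) * Complex.I)‖ := fun n => by
        have := hS n
        have := hT n
        fun_prop
      have hle : ∀ n ω, ‖Complex.exp ((t * S n ω : ℝ) * Complex.I) -
          Complex.exp ((t * T n ω : ℝ) * Complex.I)‖ ^ 2 ≤ 4 := by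
        intro n ω
        have h2 := norm_sub_le (Complex.exp ((t * S n ω : ℝ) * Complex.I))
          (Complex.exp ((t * T n ω : ℝ) * Complex.I))
        rw [Complex.norm_exp_ofReal_mul_I, Complex.norm_exp_ofReal_mul_I] at h2
        nlinarith [norm_nonneg (Complex.exp ((t * S n ω : ℝ) * Complex.I) -
          Complex.exp ((t * T n ω : ℝ) * Complex.I))]
      have hi : ∀ n, Integrable (fun ω => ‖Complex.exp ((t * S n ω : ℝ) * Complex.I) -
          Complex.exp ((t * T n ω : ℝ) * Complex.I)‖ ^ 2) (P n) := fun n =>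
        Integrable.of_bound ((hmeas n).pow_const 2).aestronglyMeasurable 4
          (ae_of_all _ fun ω => by
            rw [Real.norm_eq_abs, abs_of_nonneg (sq_nonneg _)]; exact hle n ω)
      refine tendsto_integral_of_tendsto_whp (K := 4) ?_ hmeas hi fun n => ?_
      · have h0 : Tendsto (fun x : Σ n, Ω n => |t| * |S x.1 x.2 - T x.1 x.2|) (whp P) (𝓝 0) := by
          simpa using hST.abs.const_mul |t|
        refine squeeze_zero (fun _ => norm_nonneg _) (fun x => ?_) h0
        refine (norm_exp_sub_exp_le _ _).trans (le_of_eq ?_)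
        rw [← mul_sub, abs_mul]
      · refine (integral_mono (hi n) (integrable_const 4) (hle n)).trans ?_
        simp
    have h0 : Tendsto (fun n => ∫ ω, Complex.exp ((t * S n ω : ℝ) * Complex.I) ∂(P n) -
        ∫ ω, Complex.exp ((t * T n ω : ℝ) * Complex.I) ∂(P n)) atTop (𝓝 0) := by
      refine squeeze_zero_norm (fun n => ?_) hdiff
      rw [← integral_sub (hei S hS n) (hei T hT n)]
      exact norm_integral_le_integral_norm _
    simpa using h0.add (hchar t)

variable {D : ∀ n, Experiment n p (Ω n)} {q σ : ℕ → ℝ} {q₀ σ₀ : ℝ} {muX : Fin p → ℝ}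
  {SigmaX : Matrix (Fin p) (Fin p) ℝ} {C : ℝ≥0}

lemma tendsto_armProb (hq : Tendsto q atTop (𝓝 q₀)) (w : Bool) :
    Tendsto (fun n => armProb (q n) w) atTop (𝓝 (armProb q₀ w)) := by
  cases w
  · simpa [armProb] using hq.const_sub 1
  · simpa [armProb] using hq

lemma tendsto_momentMatrix {ι : Type*} {l : Filter ι} {m : ι → Fin p → ℝ}
    {S : ι → Matrix (Fin p) (Fin p) ℝ}
    (hm : ∀ k, Tendsto (fun x => m x k) l (𝓝 (muX k)))
    (hS : ∀ j k, Tendsto (fun x => S x j k) l (𝓝 (SigmaX j k))) (j k : Fin (p + 1)) :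
    Tendsto (fun x => momentMatrix (m x) (S x) j k) l (𝓝 (momentMatrix muX SigmaX j k)) := by
  have hv : ∀ k : Fin (p + 1), Tendsto (fun x => (Matrix.vecCons 1 (m x) : Fin (p + 1) → ℝ) k) l
      (𝓝 ((Matrix.vecCons 1 muX : Fin (p + 1) → ℝ) k)) := by
    intro k
    refine Fin.cases ?_ (fun k => ?_) k
    · exact tendsto_const_nhds
    · simpa using hm k
  simp only [momentMatrix, Matrix.add_apply, Matrix.vecMulVec_apply]
  refine ((hv j).mul (hv k)).add ?_
  refine Fin.cases ?_ (fun j => ?_) j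
  · exact tendsto_const_nhds
  · refine Fin.cases ?_ (fun k => ?_) k
    · exact tendsto_const_nhds
    · simpa [borderZero] using hS j k

lemma inv_smul_of_ne_zero {κ : Type*} [Fintype κ] [DecidableEq κ] {a : ℝ} (ha : a ≠ 0)
    {A : Matrix κ κ ℝ} (hA : IsUnit A.det) : (a • A)⁻¹ = a⁻¹ • A⁻¹ := by
  refine Matrix.inv_eq_right_inv ?_
  rw [Matrix.smul_mul, Matrix.mul_smul, smul_smul, mul_inv_cancel₀ ha, one_smul,
    Matrix.mul_nonsing_inv _ hA]

lemma tendsto_matrix_inv {ι κ : Type*} [Fintype κ] [DecidableEq κ] {l : Filter ι}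
    {A : ι → Matrix κ κ ℝ} {B : Matrix κ κ ℝ} (hA : Tendsto A l (𝓝 B)) (hB : B.det ≠ 0) :
    Tendsto (fun x => (A x)⁻¹) l (𝓝 B⁻¹) := by
  simp only [Matrix.inv_def, Ring.inverse_eq_inv']
  have hdet : Tendsto (fun x => (A x).det) l (𝓝 B.det) :=
    (continuous_id.matrix_det.tendsto B).comp hA
  have hadj : Tendsto (fun x => (A x).adjugate) l (𝓝 B.adjugate) :=
    (continuous_id.matrix_adjugate.tendsto B).comp hA
  exact (hdet.inv₀ hB).smul hadj

lemma tendsto_gram (hreg : ∀ n, (D n).Regular (P n) (q n) (σ n))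
    (hq : Tendsto q atTop (𝓝 q₀))
    (hmean : ∀ k, TendstoInProb P (fun n ω => (D n).xbar ω k) (muX k))
    (hcov : ∀ k l, TendstoInProb P (fun n ω => (D n).sampleCov ω k l) (SigmaX k l))
    (hmom : ∀ n, (D n).FourthMomentsLE (P n) C)
    (hind : ∀ n, IndepFun (D n).features (D n).treatments (P n)) (w : Bool) :
    Tendsto (fun x : Σ n, Ω n => (x.1 : ℝ)⁻¹ • (D x.1).gram w x.2) (whp P)
      (𝓝 (armProb q₀ w • momentMatrix muX SigmaX)) := by
  refine tendsto_pi_nhds.2 fun k => tendsto_pi_nhds.2 fun l => ?_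
  have h1 := tendsto_momentMatrix (m := fun x : Σ n, Ω n => (D x.1).xbar x.2)
    (S := fun x : Σ n, Ω n => (D x.1).sampleCov x.2) (fun k => (hmean k).tendsto_whp)
    (fun j k => (hcov j k).tendsto_whp) k l
  have h2 := ((tendsto_armProb hq w).comp (tendsto_fst_whp (P := P))).mul h1
  have h3 : Tendsto (fun x : Σ n, Ω n => (1 / (x.1 : ℝ)) *
      ∑ i, ((D x.1).armInd w i x.2 - armProb (q x.1) w) *
        ((D x.1).regressor i x.2 k * (D x.1).regressor i x.2 l)) (whp P) (𝓝 0) :=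
    tendsto_whp_of_integral_sq_le (b := fun n => (1 + (C : ℝ)) / n)
      (Z := fun n ω => (1 / (n : ℝ)) * ∑ i, ((D n).armInd w i ω - armProb (q n) w) *
        ((D n).regressor i ω k * (D n).regressor i ω l))
      (fun n => ((hreg n).integral_sq_gram_sub_le (hmom n) (hind n) w k l).1)
      (fun n => ((hreg n).integral_sq_gram_sub_le (hmom n) (hind n) w k l).2)
      (tendsto_const_div_atTop_nhds_zero_nat _)
  have h4 := h2.add h3
  rw [add_zero] at h4
  refine h4.congr' ?_
  filter_upwards [tendsto_fst_whp.eventually (eventually_ne_atTop 0)] with x hx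
  simp only [Function.comp_apply, Matrix.smul_apply, smul_eq_mul]
  rw [← (D x.1).sum_regressor_mul_regressor hx x.2 k l]
  simp only [Experiment.gram, Matrix.of_apply, sub_mul, Finset.sum_sub_distrib,
    ← Finset.mul_sum]
  ring

lemma tendsto_vecMul_inv_gram (hreg : ∀ n, (D n).Regular (P n) (q n) (σ n))
    (hq : Tendsto q atTop (𝓝 q₀)) (hSigma : SigmaX.PosDef)
    (hmean : ∀ k, TendstoInProb P (fun n ω => (D n).xbar ω k) (muX k))
    (hcov : ∀ k l, TendstoInProb P (fun n ω => (D n).sampleCov ω k l) (SigmaX k l))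
    (hmom : ∀ n, (D n).FourthMomentsLE (P n) C)
    (hind : ∀ n, IndepFun (D n).features (D n).treatments (P n)) (w : Bool)
    (hw : armProb q₀ w ≠ 0) {m : ℕ → Fin p → ℝ} (hm : Tendsto m atTop (𝓝 muX))
    (k : Fin (p + 1)) :
    (∀ᶠ x : Σ n, Ω n in whp P, IsUnit ((D x.1).gram w x.2).det) ∧
    Tendsto (fun x : Σ n, Ω n =>
      (Matrix.vecCons 1 (m x.1) ᵥ* ((x.1 : ℝ)⁻¹ • (D x.1).gram w x.2)⁻¹) k) (whp P)
      (𝓝 ((armProb q₀ w)⁻¹ * (Pi.single 0 1 : Fin (p + 1) → ℝ) k)) := by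
  have hG := tendsto_gram hreg hq hmean hcov hmom hind w
  have hM := (Matrix.isUnit_iff_isUnit_det _).1 (isUnit_momentMatrix muX hSigma)
  have hdet : (armProb q₀ w • momentMatrix muX SigmaX).det ≠ 0 := by
    rw [Matrix.det_smul]
    exact mul_ne_zero (pow_ne_zero _ hw) hM.ne_zero
  constructor
  · have hd := (continuous_id.matrix_det.tendsto _).comp hG
    filter_upwards [hd.eventually_ne hdet] with x hx
    simp only [Function.comp_apply, id_eq, Matrix.det_smul] at hx
    exact (right_ne_zero_of_mul hx).isUnit
  · have hinv := tendsto_matrix_inv hG hdet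
    have hv : Tendsto (fun x : Σ n, Ω n => (Matrix.vecCons 1 (m x.1) : Fin (p + 1) → ℝ)) (whp P)
        (𝓝 (Matrix.vecCons 1 muX)) := by
      refine tendsto_pi_nhds.2 fun k => ?_
      refine Fin.cases ?_ (fun k => ?_) k
      · exact tendsto_const_nhds
      · simpa using (tendsto_pi_nhds.1 (hm.comp (tendsto_fst_whp (P := P)))) k
    have hmul : (Matrix.vecCons 1 muX ᵥ* (armProb q₀ w • momentMatrix muX SigmaX)⁻¹) k =
        (armProb q₀ w)⁻¹ * (Pi.single 0 1 : Fin (p + 1) → ℝ) k := by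
      rw [inv_smul_of_ne_zero hw hM, Matrix.vecMul_smul, vecMul_inv_momentMatrix muX hSigma]
      simp
    rw [← hmul]
    simp only [Matrix.vecMul, dotProduct]
    refine tendsto_finsetSum _ fun j _ => ?_
    exact (tendsto_pi_nhds.1 hv j).mul (tendsto_pi_nhds.1 (tendsto_pi_nhds.1 hinv j) k)

/-- The leading term of the normalized estimation error. -/
noncomputable def leadingTerm {n : ℕ} {Ω' : Type*} [MeasurableSpace Ω'] (D : Experiment n p Ω')
    (q₀ : ℝ) (ω : Ω') : ℝ :=
  (armProb q₀ true)⁻¹ * ((√(n : ℝ))⁻¹ * D.score true ω 0) -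
    (armProb q₀ false)⁻¹ * ((√(n : ℝ))⁻¹ * D.score false ω 0)

lemma measurable_leadingTerm {n : ℕ} {Ω' : Type*} [MeasurableSpace Ω'] (D : Experiment n p Ω')
    (q₀ : ℝ) : Measurable (leadingTerm D q₀) :=
  (((D.measurable_score true 0).const_mul _).const_mul _).sub
    (((D.measurable_score false 0).const_mul _).const_mul _)

lemma sqrt_mul_dotProduct_inv_mulVec {n r : ℕ} (hn : n ≠ 0) (v s : Fin r → ℝ)
    {G : Matrix (Fin r) (Fin r) ℝ} (hG : IsUnit G.det) :
    √(n : ℝ) * (v ⬝ᵥ G⁻¹ *ᵥ s) =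
      ∑ k, (v ᵥ* ((n : ℝ)⁻¹ • G)⁻¹) k * ((√(n : ℝ))⁻¹ * s k) := by
  have hn' : (n : ℝ) ≠ 0 := by exact_mod_cast hn
  rw [inv_smul_of_ne_zero (inv_ne_zero hn') hG, inv_inv, Matrix.vecMul_smul,
    Matrix.dotProduct_mulVec, dotProduct, Finset.mul_sum]
  refine Finset.sum_congr rfl fun k _ => ?_
  have hs : √(n : ℝ) ≠ 0 := by positivity
  have h2 : (n : ℝ) * (√(n : ℝ))⁻¹ = √(n : ℝ) := by
    nth_rewrite 1 [← Real.mul_self_sqrt (Nat.cast_nonneg n)]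
    field_simp
  simp only [Pi.smul_apply, smul_eq_mul]
  linear_combination (-(v ᵥ* G⁻¹) k * s k) * h2

lemma tendsto_error_sub_leadingTerm (hreg : ∀ n, (D n).Regular (P n) (q n) (σ n))
    (hq₀ : 0 < q₀) (hq₀' : q₀ < 1)
    (hq : Tendsto q atTop (𝓝 q₀)) (hσ : Tendsto (fun n => σ n ^ 2) atTop (𝓝 (σ₀ ^ 2)))
    (hSigma : SigmaX.PosDef)
    (hmean : ∀ k, TendstoInProb P (fun n ω => (D n).xbar ω k) (muX k))
    (hcov : ∀ k l, TendstoInProb P (fun n ω => (D n).sampleCov ω k l) (SigmaX k l))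
    (hmom : ∀ n, (D n).FourthMomentsLE (P n) C)
    (hind : ∀ n, IndepFun (D n).features (D n).treatments (P n))
    (homega : ∀ n w k, (D n).omega (P n) w k = ∫ ω, (D n).xbar ω k ∂(P n))
    (hlim : ∀ w, Tendsto (fun n => (D n).omega (P n) w) atTop (𝓝 muX)) :
    Tendsto (fun x : Σ n, Ω n =>
      √(x.1 : ℝ) * ((D x.1).tauHat (P x.1) x.2 - (D x.1).gate (P x.1)) -
        leadingTerm (D x.1) q₀ x.2) (whp P) (𝓝 0) := by
  have hw : ∀ w, armProb q₀ w ≠ 0 := by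
    intro w
    cases w
    · simpa [armProb] using (sub_pos.2 hq₀').ne'
    · simpa [armProb] using hq₀.ne'
  have hcoef := fun w k => tendsto_vecMul_inv_gram hreg hq hSigma hmean hcov hmom hind w (hw w)
    (hlim w) k
  have hσb : ∀ᶠ n in atTop, σ n ^ 2 ≤ σ₀ ^ 2 + 1 :=
    (hσ.eventually_lt_const (lt_add_one _)).mono fun n hn => hn.le
  have hterm : ∀ w k, Tendsto (fun x : Σ n, Ω n =>
      ((Matrix.vecCons 1 ((D x.1).omega (P x.1) w) ᵥ* ((x.1 : ℝ)⁻¹ • (D x.1).gram w x.2)⁻¹) k -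
        (armProb q₀ w)⁻¹ * (Pi.single 0 1 : Fin (p + 1) → ℝ) k) *
        ((√(x.1 : ℝ))⁻¹ * (D x.1).score w x.2 k)) (whp P) (𝓝 0) := by
    intro w k
    refine tendsto_whp_zero_mul_of_integral_sq_le (K := (σ₀ ^ 2 + 1) * (1 + C))
      (Z := fun n ω => (√(n : ℝ))⁻¹ * (D n).score w ω k) ?_
      (fun n => ((hreg n).integral_sq_score_le (hmom n) w k).1) ?_
    · simpa using (hcoef w k).2.sub_const ((armProb q₀ w)⁻¹ * (Pi.single 0 1 : Fin (p + 1) → ℝ) k)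
    · filter_upwards [hσb] with n hn
      refine ((hreg n).integral_sq_score_le (hmom n) w k).2.trans ?_
      gcongr
  have hsum : ∀ w, Tendsto (fun x : Σ n, Ω n => ∑ k,
      ((Matrix.vecCons 1 ((D x.1).omega (P x.1) w) ᵥ* ((x.1 : ℝ)⁻¹ • (D x.1).gram w x.2)⁻¹) k -
        (armProb q₀ w)⁻¹ * (Pi.single 0 1 : Fin (p + 1) → ℝ) k) *
        ((√(x.1 : ℝ))⁻¹ * (D x.1).score w x.2 k)) (whp P) (𝓝 0) := fun w => by
    simpa using tendsto_finsetSum Finset.univ fun k _ => hterm w k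
  have hdiff := (hsum true).sub (hsum false)
  rw [sub_zero] at hdiff
  refine hdiff.congr' ?_
  filter_upwards [tendsto_fst_whp.eventually (eventually_ne_atTop 0), (hcoef true 0).1,
    (hcoef false 0).1] with x hx h1 h0
  have hom : ∀ w, (D x.1).omega (P x.1) w = fun k => ∫ ω, (D x.1).xbar ω k ∂(P x.1) :=
    fun w => funext fun k => homega x.1 w k
  have hs : ∀ w, ∑ k,
      ((Matrix.vecCons 1 ((D x.1).omega (P x.1) w) ᵥ* ((x.1 : ℝ)⁻¹ • (D x.1).gram w x.2)⁻¹) k -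
        (armProb q₀ w)⁻¹ * (Pi.single 0 1 : Fin (p + 1) → ℝ) k) *
        ((√(x.1 : ℝ))⁻¹ * (D x.1).score w x.2 k) =
      ∑ k, (Matrix.vecCons 1 ((D x.1).omega (P x.1) w) ᵥ*
        ((x.1 : ℝ)⁻¹ • (D x.1).gram w x.2)⁻¹) k * ((√(x.1 : ℝ))⁻¹ * (D x.1).score w x.2 k) -
        (armProb q₀ w)⁻¹ * ((√(x.1 : ℝ))⁻¹ * (D x.1).score w x.2 0) := by
    intro w
    simp only [sub_mul, Finset.sum_sub_distrib]
    congr 1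
    rw [Finset.sum_eq_single 0]
    · simp
    · intro k _ hk
      simp [hk]
    · simp
  rw [hs, hs, ← sqrt_mul_dotProduct_inv_mulVec hx _ _ h1,
    ← sqrt_mul_dotProduct_inv_mulVec hx _ _ h0, leadingTerm, Experiment.tauHat,
    (hreg x.1).gate_eq (hmom x.1) (hind x.1) hx, (D x.1).betaHat_eq_beta_add h1,
    (D x.1).betaHat_eq_beta_add h0, dotProduct_add, dotProduct_add, hom, hom]
  ring

/-- The coefficient of the error of unit `i` in the leading term, scaled by `t`. -/
noncomputable def leadingCoef {n : ℕ} (q₀ t : ℝ) (z : (Fin n → Fin p → ℝ) × (Fin n → Bool))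
    (i : Fin n) : ℝ :=
  t * (√(n : ℝ))⁻¹ * ((armProb q₀ true)⁻¹ * Experiment.armIndOf true i z -
    (armProb q₀ false)⁻¹ * Experiment.armIndOf false i z)

lemma measurable_leadingCoef {n : ℕ} (q₀ t : ℝ) (i : Fin n) :
    Measurable fun z : (Fin n → Fin p → ℝ) × (Fin n → Bool) => leadingCoef q₀ t z i :=
  (((Experiment.measurable_armIndOf true i).const_mul _).sub
    ((Experiment.measurable_armIndOf false i).const_mul _)).const_mul _

lemma abs_leadingCoef_le {n : ℕ} (q₀ t : ℝ) (z : (Fin n → Fin p → ℝ) × (Fin n → Bool))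
    (i : Fin n) : |leadingCoef q₀ t z i| ≤
      |t| * (|armProb q₀ true|⁻¹ + |armProb q₀ false|⁻¹) * (√(n : ℝ))⁻¹ := by
  have h : |(armProb q₀ true)⁻¹ * Experiment.armIndOf true i z -
      (armProb q₀ false)⁻¹ * Experiment.armIndOf false i z| ≤
      |armProb q₀ true|⁻¹ + |armProb q₀ false|⁻¹ := by
    unfold Experiment.armIndOf
    by_cases hz : z.2 i = true <;> simp [hz, abs_inv]
  rw [leadingCoef, abs_mul, abs_mul, abs_of_nonneg (a := (√(n : ℝ))⁻¹) (by positivity)]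
  calc _ ≤ |t| * (√(n : ℝ))⁻¹ * (|armProb q₀ true|⁻¹ + |armProb q₀ false|⁻¹) := by gcongr
    _ = _ := by ring

lemma sum_leadingCoef_mul_error {n : ℕ} {Ω' : Type*} [MeasurableSpace Ω']
    (D : Experiment n p Ω') (q₀ t : ℝ) (ω : Ω') :
    ∑ i, leadingCoef q₀ t (D.design ω) i * D.ε i ω = t * leadingTerm D q₀ ω := by
  have h0 : ∀ i, D.regressor i ω 0 = 1 := fun i => rfl
  have ha : ∀ w i, Experiment.armIndOf w i (D.design ω) = D.armInd w i ω := fun w i => rfl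
  simp only [leadingTerm, Experiment.score, leadingCoef, h0, ha, one_mul, Finset.mul_sum,
    ← Finset.sum_sub_distrib]
  exact Finset.sum_congr rfl fun i _ => by ring

lemma sum_leadingCoef_sq {n : ℕ} {Ω' : Type*} [MeasurableSpace Ω']
    (D : Experiment n p Ω') (q₀ t : ℝ) (ω : Ω') :
    ∑ i, leadingCoef q₀ t (D.design ω) i ^ 2 =
      t ^ 2 * ((armProb q₀ true)⁻¹ ^ 2 * ((n : ℝ)⁻¹ • D.gram true ω) 0 0 +
        (armProb q₀ false)⁻¹ ^ 2 * ((n : ℝ)⁻¹ • D.gram false ω) 0 0) := by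
  have h0 : ∀ i, D.regressor i ω 0 = 1 := fun i => rfl
  have hs : ((√(n : ℝ))⁻¹) ^ 2 = (n : ℝ)⁻¹ := by
    rw [inv_pow, Real.sq_sqrt (Nat.cast_nonneg n)]
  have hi : ∀ i, leadingCoef q₀ t (D.design ω) i ^ 2 =
      t ^ 2 * (n : ℝ)⁻¹ * ((armProb q₀ true)⁻¹ ^ 2 * D.armInd true i ω +
        (armProb q₀ false)⁻¹ ^ 2 * D.armInd false i ω) := by
    intro i
    have ha : ∀ w, Experiment.armIndOf w i (D.design ω) = D.armInd w i ω := fun w => rfl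
    rw [leadingCoef, mul_pow, mul_pow, hs, ha, ha]
    congr 1
    unfold Experiment.armInd
    by_cases hz : D.W i ω = true <;> simp [hz]
  simp only [hi, Matrix.smul_apply, Experiment.gram, Matrix.of_apply, h0, mul_one, smul_eq_mul,
    ← Finset.mul_sum, Finset.sum_add_distrib]
  ring

lemma tendsto_charFun_leadingTerm (hreg : ∀ n, (D n).Regular (P n) (q n) (σ n))
    (hq₀ : 0 < q₀) (hq₀' : q₀ < 1)
    (hq : Tendsto q atTop (𝓝 q₀)) (hσ : Tendsto (fun n => σ n ^ 2) atTop (𝓝 (σ₀ ^ 2)))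
    (hmean : ∀ k, TendstoInProb P (fun n ω => (D n).xbar ω k) (muX k))
    (hcov : ∀ k l, TendstoInProb P (fun n ω => (D n).sampleCov ω k l) (SigmaX k l))
    (hmom : ∀ n, (D n).FourthMomentsLE (P n) C)
    (hind : ∀ n, IndepFun (D n).features (D n).treatments (P n)) (t : ℝ) :
    Tendsto (fun n => ∫ ω, Complex.exp ((t * leadingTerm (D n) q₀ ω : ℝ) * Complex.I) ∂(P n))
      atTop (𝓝 (charFun (gaussianReal 0 (Real.toNNReal (σ₀ ^ 2 / (q₀ * (1 - q₀))))) t)) := by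
  set B : ℝ := |t| * (|armProb q₀ true|⁻¹ + |armProb q₀ false|⁻¹)
  have hV : 0 ≤ σ₀ ^ 2 / (q₀ * (1 - q₀)) :=
    div_nonneg (sq_nonneg _) (mul_nonneg hq₀.le (sub_nonneg.2 hq₀'.le))
  have hlimit : charFun (gaussianReal 0 (Real.toNNReal (σ₀ ^ 2 / (q₀ * (1 - q₀))))) t =
      ((Real.exp (-(σ₀ ^ 2 / 2 * (t ^ 2 * ((armProb q₀ true)⁻¹ ^ 2 * armProb q₀ true +
        (armProb q₀ false)⁻¹ ^ 2 * armProb q₀ false)))) : ℝ) : ℂ) := by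
    rw [charFun_gaussianReal, Complex.ofReal_exp]
    have hr : ((Real.toNNReal (σ₀ ^ 2 / (q₀ * (1 - q₀))) : ℝ≥0) : ℝ) =
        σ₀ ^ 2 / (q₀ * (1 - q₀)) := Real.coe_toNNReal _ hV
    have h1 : (1 - q₀) ≠ 0 := (sub_pos.2 hq₀').ne'
    have he : -(σ₀ ^ 2 / 2 * (t ^ 2 * ((armProb q₀ true)⁻¹ ^ 2 * armProb q₀ true +
        (armProb q₀ false)⁻¹ ^ 2 * armProb q₀ false))) =
        -(σ₀ ^ 2 / (q₀ * (1 - q₀)) * t ^ 2 / 2) := by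
      have h0 : q₀ ≠ 0 := hq₀.ne'
      simp only [armProb, if_true, Bool.false_eq_true, if_false]
      field_simp
      ring
    rw [he]
    nth_rewrite 2 [← hr]
    congr 1
    push_cast
    ring
  rw [hlimit]
  have hgram : ∀ w, Tendsto (fun x : Σ n, Ω n => ((x.1 : ℝ)⁻¹ • (D x.1).gram w x.2) 0 0) (whp P)
      (𝓝 (armProb q₀ w)) := by
    intro w
    have := tendsto_pi_nhds.1 (tendsto_pi_nhds.1
      (tendsto_gram hreg hq hmean hcov hmom hind w) 0) 0
    simpa [momentMatrix_zero_row] using this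
  have hvar : Tendsto (fun x : Σ n, Ω n => Real.exp (-(σ x.1 ^ 2 / 2 *
      ∑ i, leadingCoef q₀ t ((D x.1).design x.2) i ^ 2))) (whp P)
      (𝓝 (Real.exp (-(σ₀ ^ 2 / 2 * (t ^ 2 * ((armProb q₀ true)⁻¹ ^ 2 * armProb q₀ true +
        (armProb q₀ false)⁻¹ ^ 2 * armProb q₀ false)))))) := by
    simp only [sum_leadingCoef_sq]
    exact (Real.continuous_exp.tendsto _).comp
      ((((hσ.comp (tendsto_fst_whp (P := P))).div_const 2).mul
        ((((hgram true).const_mul _).add ((hgram false).const_mul _)).const_mul _)).neg)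
  have hmeas : ∀ n, Measurable fun ω => Real.exp (-(σ n ^ 2 / 2 *
      ∑ i, leadingCoef q₀ t ((D n).design ω) i ^ 2)) := fun n =>
    ((Finset.measurable_sum _ fun i _ => ((measurable_leadingCoef q₀ t i).comp
      (D n).measurable_design).pow_const 2).const_mul _).neg.exp
  have hle : ∀ n ω, Real.exp (-(σ n ^ 2 / 2 *
      ∑ i, leadingCoef q₀ t ((D n).design ω) i ^ 2)) ^ 2 ≤ 1 := by
    intro n ω
    refine pow_le_one₀ (Real.exp_pos _).le ?_
    rw [Real.exp_le_one_iff, neg_nonpos]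
    exact mul_nonneg (by positivity) (Finset.sum_nonneg fun i _ => sq_nonneg _)
  have hi : ∀ n, Integrable (fun ω => Real.exp (-(σ n ^ 2 / 2 *
      ∑ i, leadingCoef q₀ t ((D n).design ω) i ^ 2)) ^ 2) (P n) := fun n =>
    Integrable.of_bound ((hmeas n).pow_const 2).aestronglyMeasurable 1
      (ae_of_all _ fun ω => by
        rw [Real.norm_eq_abs, abs_of_nonneg (sq_nonneg _)]; exact hle n ω)
  have hE := tendsto_integral_of_tendsto_whp (K := 1)
    (Z := fun n ω => Real.exp (-(σ n ^ 2 / 2 * ∑ i, leadingCoef q₀ t ((D n).design ω) i ^ 2)))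
    hvar hmeas hi
    (fun n => (integral_mono (hi n) (integrable_const 1) (hle n)).trans (by simp))
  have hEc := (Complex.continuous_ofReal.tendsto _).comp hE
  have hs0 : Tendsto (fun n : ℕ => (√(n : ℝ))⁻¹) atTop (𝓝 0) :=
    (Real.tendsto_sqrt_atTop.comp tendsto_natCast_atTop_atTop).inv_tendsto_atTop
  have hrate : Tendsto (fun n : ℕ => 4 * B ^ 3 * (1 + (C : ℝ)) * (√(n : ℝ))⁻¹ +
      B ^ 4 * (σ n ^ 2) ^ 2 * (√(n : ℝ))⁻¹ ^ 2) atTop (𝓝 0) := by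
    have := (hs0.const_mul (4 * B ^ 3 * (1 + (C : ℝ)))).add
      (((hσ.pow 2).const_mul (B ^ 4)).mul (hs0.pow 2))
    simpa using this
  have hdiff : Tendsto (fun n =>
      ∫ ω, Complex.exp ((t * leadingTerm (D n) q₀ ω : ℝ) * Complex.I) ∂(P n) -
      ((∫ ω, Real.exp (-(σ n ^ 2 / 2 * ∑ i, leadingCoef q₀ t ((D n).design ω) i ^ 2))
        ∂(P n) : ℝ) : ℂ)) atTop (𝓝 0) := by
    refine squeeze_zero_norm' ?_ hrate
    filter_upwards [eventually_ne_atTop 0] with n hn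
    have hb := (hreg n).norm_charFun_sub_le (hmom n) (c := leadingCoef q₀ t)
      (measurable_leadingCoef q₀ t) (abs_leadingCoef_le q₀ t)
    simp only [sum_leadingCoef_mul_error] at hb
    refine hb.trans (le_of_eq ?_)
    have hn' : (0 : ℝ) < n := by exact_mod_cast Nat.pos_of_ne_zero hn
    have h2 : (n : ℝ) * ((√(n : ℝ))⁻¹) ^ 2 = 1 := by
      rw [inv_pow, Real.sq_sqrt hn'.le, mul_inv_cancel₀ hn'.ne']
    have e : ∀ r : ℝ, (n : ℝ) * r ^ 2 = 1 →
        n * (4 * (B * r) ^ 3 * (1 + (C : ℝ)) + (B * r) ^ 4 * σ n ^ 4) =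
        4 * B ^ 3 * (1 + (C : ℝ)) * r + B ^ 4 * (σ n ^ 2) ^ 2 * r ^ 2 := by
      intro r hr
      linear_combination (4 * B ^ 3 * (1 + (C : ℝ)) * r + B ^ 4 * σ n ^ 4 * r ^ 2) * hr
    exact e _ h2
  simpa using hdiff.add hEc

end Limits

theorem corollary1 {p : ℕ} {Ω : ℕ → Type*} [∀ n, MeasurableSpace (Ω n)]
    (P : ∀ n, Measure (Ω n)) [∀ n, IsProbabilityMeasure (P n)]
    (D : ∀ n, Experiment n p (Ω n))
    (q σ : ℕ → ℝ) (q₀ σ₀ : ℝ)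
    (hreg : ∀ n, (D n).Regular (P n) (q n) (σ n))
    -- limits of the parameters
    (hq₀ : 0 < q₀) (hq₀' : q₀ < 1)
    (hq : Tendsto q atTop (𝓝 q₀))
    (hσ : Tendsto (fun n => σ n ^ 2) atTop (𝓝 (σ₀ ^ 2)))
    -- convergence of the sample moments
    (muX : Fin p → ℝ) (SigmaX : Matrix (Fin p) (Fin p) ℝ) (hSigma : SigmaX.PosDef)
    (hmean : ∀ k, TendstoInProb P (fun n ω => (D n).xbar ω k) (muX k))
    (hcov : ∀ k l, TendstoInProb P (fun n ω => (D n).sampleCov ω k l) (SigmaX k l))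
    -- bounded fourth moments
    (hmom : ∃ C : ℝ≥0, ∀ n, (D n).FourthMomentsLE (P n) C)
    -- either the features are functions of the indirect treatments, or else (random features)
    -- the feature array is independent of the treatment vector
    (hfeat : ∀ n, (D n).FeaturesOfIndirect (P n) ∨
      IndepFun (D n).features (D n).treatments (P n))
    -- the features are static
    (hstatic : ∀ n i, IndepFun ((D n).X i) ((D n).indirect i) (P n)) :
    (∀ n w k, (D n).omega (P n) w k = ∫ ω, (D n).xbar ω k ∂(P n)) ∧
    (∀ w, Tendsto (fun n => (D n).omega (P n) w) atTop (𝓝 muX)) ∧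
    TendstoInDistribution
      (fun (n : ℕ) ω => √(n : ℝ) * ((D n).tauHat (P n) ω - (D n).gate (P n))) atTop
      id P (gaussianReal 0 (Real.toNNReal (σ₀ ^ 2 / (q₀ * (1 - q₀))))) := by
  obtain ⟨C, hmom⟩ := hmom
  have hind : ∀ n, IndepFun (D n).features (D n).treatments (P n) := fun n =>
    (hreg n).indepFun_features_treatments (hfeat n) (hstatic n)
  have homega : ∀ n w k, (D n).omega (P n) w k = ∫ ω, (D n).xbar ω k ∂(P n) := fun n =>
    (hreg n).omega_eq (hmom n) (hstatic n)
  have hlim : ∀ w, Tendsto (fun n => (D n).omega (P n) w) atTop (𝓝 muX) := by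
    refine fun w => tendsto_pi_nhds.2 fun k => ?_
    simp only [homega]
    exact tendsto_integral_of_tendsto_whp (hmean k).tendsto_whp
      (fun n => (D n).measurable_xbar k) (fun n => ((hmom n).xbar_sq k).1)
      (fun n => ((hmom n).xbar_sq k).2)
  refine ⟨homega, hlim, ?_⟩
  exact tendstoInDistribution_of_tendsto_charFun
    (fun n => (((D n).measurable_tauHat (P n)).sub_const _).const_mul _)
    (fun n => measurable_leadingTerm (D n) q₀)
    (tendsto_error_sub_leadingTerm hreg hq₀ hq₀' hq hσ hSigma hmean hcov hmom hind homega hlim)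
    (tendsto_charFun_leadingTerm hreg hq₀ hq₀' hq hσ hmean hcov hmom hind)
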